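/- Let $z\in\mathbb R^2$ be an interior vertex of a regular triangulation and let its nodal patch $\mathcal T(z)=\{T_1,\dots,T_m\}$ consist of the $m\ge 3$ triangles $T_j=\mathrm{conv}\{z,P_j,P_{j+1}\}$ (indices cyclic modulo $m$), with vertices $z,P_j,P_{j+1}$ in counterclockwise order; two different triangles of the patch meet exactly in the convex hull of their common vertices, and $z$ is an interior point of $\bigcup_j T_j$. Let $E_j=\mathrm{conv}\{z,P_j\}$, let $t_j=(z-P_j)/|E_j|$ be its unit tangent and $n_j$ its unit normal pointing from $T_{j-1}$ into $T_j$. Let $\varphi_z,\varphi_1,\dots,\varphi_m$ be the continuous piecewise affine nodal basis functions of the vertices $z,P_1,\dots,P_m$ of the patch. Let $p\ge 3$ be odd and let $L_p$ be the Legendre polynomial of degree $p$ with $L_p(1)=1$. Set $$\psi_j=\frac{6}{L_p'(1)}\Bigl(L_p(1-2\varphi_k)+(5L_p'(1)-30)\,\varphi_z^2\varphi_j^2\Bigr)$$ on $T_j$ with $k=j+1$ and on $T_{j-1}$ with $k=j-1$, and $\psi_j=0$ on the other triangles. For $j=1,\dots,m$ put $$b_{5j-4}=\varphi_j\varphi_z^2\,n_j,\quad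 b_{5j-3}=\varphi_j\varphi_z^2\,t_j,\quad b_{5j-2}=\varphi_j^2\varphi_z\,n_j,\quad b_{5j-1}=\varphi_j^2\varphi_z\,t_j,\quad b_{5j}=\psi_j\,n_j,$$ and let $V(z)$ be the span of $b_1,\dots,b_{5m}$. For a piecewise polynomial $g$ let $$(\Lambda_{4j-3},\Lambda_{4j-2},\Lambda_{4j-1},\Lambda_{4j})(g)=\Bigl(g|_{T_j}(z),\,g|_{T_j}(P_j),\,g|_{T_j}(P_{j+1}),\,\int_{T_j}g\,dx\Bigr).$$ With the piecewise divergence $\mathrm{div}_{pw}$ define $\mathbf M\in\mathbb R^{5m\times 4m}$ by $\mathbf M_{k\ell}=\Lambda_\ell(\mathrm{div}_{pw}\,b_k)$ and $\mathbf A=\mathbf D_L\mathbf M\mathbf D_R$, where $\mathbf D_L$ is block diagonal with blocks $\mathrm{diag}(|E_j|,-|E_j|,|E_j|,|E_j|,|E_j|/12)$ and $\mathbf D_R$ is block diagonal with blocks $\mathrm{diag}(1,1,1,6/|T_j|)$, $j=1,\dots,m$. Let $\mathbf e_i$ be the canonical unit vectors of $\mathbb R^{4m}$. Let $\mathrm{CR}^p_0(\mathcal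 T(z);\mathbb R^2)$ be the space of vector fields that are polynomial of total degree at most $p$ on each $T_j$, are continuous at the Gauss points of each edge $E_j$, and vanish at the Gauss points of each outer edge $\mathrm{conv}\{P_j,P_{j+1}\}$; the Gauss points of an edge are the affine images of the zeros of $L_p$ in $(-1,1)$. Let $B_p(\mathcal T(z))$ be the space of vector fields that are polynomial of total degree at most $p$ on each $T_j$ and vanish on the boundary of each $T_j$. Let $P_{p-1}(\mathcal T(z))/\mathbb R$ be the space of piecewise polynomials of total degree at most $p-1$ with vanishing integral over the patch. Then: 1. $\ker\mathbf A=\mathrm{span}\{\mathbf v_0\}$ with $\mathbf v_0=\sum_{j=1}^m|T_j|\,\mathbf e_{4j}$, and $\ker\mathbf A$ is one-dimensional. 2. $\ker\mathbf M=\mathrm{span}\{\mathbf s\}$ with $\mathbf s=\sum_{j=1}^m\mathbf e_{4j}$. 3. $V(z)$ and $B_p(\mathcal T(z))$ are subspaces of $\mathrm{CR}^p_0(\mathcal T(z);\mathbb R^2)$ with $V(z)\cap B_p(\mathcal T(z))=\{0\}$, and $\mathrm{div}_{pw}$ maps $V(z)\oplus B_p(\mathcal T(z))$ onto $P_{p-1}(\mathcal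 T(z))/\mathbb R$ (its image is exactly this space). -/

import Mathlib

open MeasureTheory

noncomputable section

namespace CrouzeixRaviart

/-- The Euclidean plane. -/
abbrev Plane := EuclideanSpace ℝ (Fin 2)

/-- Real polynomials in the two coordinates of the plane. -/
abbrev Poly := MvPolynomial (Fin 2) ℝ

/-- The value of a polynomial at a point of the plane. -/
def evalAt (x : Plane) (q : Poly) : ℝ := MvPolynomial.eval (fun i => x i) q

/-- The closed triangle with vertices `A`, `B`, `C`. -/
def triangle (A B C : Plane) : Set Plane := convexHull ℝ {A, B, C}

/-- The boundary of the triangle with vertices `A`, `B`, `C`: the union of its three edges. -/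
def triangleBoundary (A B C : Plane) : Set Plane :=
  segment ℝ A B ∪ segment ℝ B C ∪ segment ℝ C A

/-- The determinant of `(B - A, C - A)`, twice the signed area of the triangle. -/
def orient (A B C : Plane) : ℝ :=
  (B 0 - A 0) * (C 1 - A 1) - (B 1 - A 1) * (C 0 - A 0)

/-- The barycentric coordinate of the triangle with vertices `A`, `B`, `C` that belongs to the
vertex `A`: the affine polynomial with value `1` at `A` and value `0` at `B` and `C`, that is,
`x ↦ det (B - x, C - x) / det (B - A, C - A)`. -/
def bary (A B C : Plane) : Poly :=
  MvPolynomial.C (orient A B C)⁻¹ *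
    ((MvPolynomial.C (B 0) - MvPolynomial.X 0) * (MvPolynomial.C (C 1) - MvPolynomial.X 1) -
      (MvPolynomial.C (B 1) - MvPolynomial.X 1) * (MvPolynomial.C (C 0) - MvPolynomial.X 0))

/-- The Legendre polynomial of degree `p`, with value `1` at `1` (formula of Rodrigues). -/
def legendre (p : ℕ) : Polynomial ℝ :=
  Polynomial.C ((2 ^ p * (p.factorial : ℝ))⁻¹) *
    Polynomial.derivative^[p] ((Polynomial.X ^ 2 - 1) ^ p)

/-- The Gauss points of order `p` of the edge `conv {A, B}`: the affine images of the zeros of the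
Legendre polynomial of degree `p` in the interval `(-1, 1)`. -/
def gaussPoints (p : ℕ) (A B : Plane) : Set Plane :=
  {x | ∃ t ∈ Set.Ioo (-1 : ℝ) 1, (legendre p).eval t = 0 ∧
    x = AffineMap.lineMap A B ((1 + t) / 2)}

/-- The nodal patch of an interior vertex `z` of a regular triangulation: `m ≥ 3` triangles
`T j = conv {z, P j, P (j + 1)}`, the index `j` being cyclic, each with its vertices in
counterclockwise order. Two different triangles of the patch meet exactly in the convex hull of
their common vertices, and `z` is an interior point of the union of the triangles. -/
structure NodalPatch (m : ℕ) where
  /-- the interior vertex -/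
  z : Plane
  /-- the outer vertices in counterclockwise order -/
  P : ZMod m → Plane
  three_le : 3 ≤ m
  counterclockwise : ∀ j, 0 < orient z (P j) (P (j + 1))
  regular : ∀ i j, i ≠ j →
    triangle z (P i) (P (i + 1)) ∩ triangle z (P j) (P (j + 1)) =
      convexHull ℝ (({z, P i, P (i + 1)} : Set Plane) ∩ {z, P j, P (j + 1)})
  interior_vertex : z ∈ interior (⋃ j, triangle z (P j) (P (j + 1)))

/-- The integral of polynomials over a triangle, as a linear functional. -/
def triangleIntegral (A B C : Plane) : Poly →ₗ[ℝ] ℝ where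
  toFun q := ∫ x in triangle A B C, evalAt x q
  map_add' := by
    have hint : ∀ q : Poly, IntegrableOn (fun x => evalAt x q) (triangle A B C) := by
      intro q
      have hc : Continuous (fun x : Plane => evalAt x q) := by
        unfold evalAt
        exact (MvPolynomial.continuous_eval q).comp (by fun_prop)
      have hk : IsCompact (triangle A B C) :=
        Set.Finite.isCompact_convexHull (𝕜 := ℝ) (Set.toFinite _)
      exact hc.continuousOn.integrableOn_compact hk
    intro q r
    rw [← integral_add (hint q) (hint r)]
    simp [evalAt]
  map_smul' := by
    intro c q
    simp [evalAt, MvPolynomial.smul_eval, integral_const_mul]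

namespace NodalPatch

variable {m : ℕ} (K : NodalPatch m)

/-- The triangle with number `j`. -/
def T (j : ZMod m) : Set Plane := triangle K.z (K.P j) (K.P (j + 1))

/-- The area of the triangle with number `j`. -/
def area (j : ZMod m) : ℝ := volume.real (K.T j)

/-- The length of the edge `E j = conv {z, P j}`. -/
def edgeLength (j : ZMod m) : ℝ := ‖K.z - K.P j‖

/-- The unit tangent `(z - P j) / |E j|` of the edge `E j`. -/
def tangent (j : ZMod m) : Plane := (K.edgeLength j)⁻¹ • (K.z - K.P j)

/-- The unit normal of the edge `E j`, pointing from the triangle `T (j - 1)` into `T j`. -/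
def normal (j : ZMod m) : Plane := !₂[K.tangent j 1, -K.tangent j 0]

end NodalPatch

/-- Piecewise polynomial scalar functions on a patch of `m` triangles: the component with index
`j` is the polynomial that the function equals on the triangle `T j`. No continuity across the
edges is imposed. -/
abbrev PwPoly (m : ℕ) := ZMod m → Poly

/-- Piecewise polynomial vector fields with values in `ℝ²` on a patch of `m` triangles. -/
abbrev PwField (m : ℕ) := ZMod m → Fin 2 → Poly

/-- The piecewise divergence. -/
def divPw (m : ℕ) : PwField m →ₗ[ℝ] PwPoly m where
  toFun v j := ∑ i, MvPolynomial.pderiv i (v j i)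
  map_add' v w := by
    funext j
    simp [Finset.sum_add_distrib, add_add_add_comm]
  map_smul' c v := by
    funext j
    simp

/-- Piecewise polynomials of total degree at most `k`. -/
def PwPolyLE (m k : ℕ) : Submodule ℝ (PwPoly m) :=
  Submodule.pi Set.univ fun _ => MvPolynomial.restrictTotalDegree (Fin 2) ℝ k

/-- Piecewise polynomial vector fields whose components have total degree at most `k`. -/
def PwFieldLE (m k : ℕ) : Submodule ℝ (PwField m) :=
  Submodule.pi Set.univ fun _ =>
    Submodule.pi Set.univ fun _ => MvPolynomial.restrictTotalDegree (Fin 2) ℝ k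

/-- The product of a piecewise polynomial scalar function with a constant vector. -/
def PwPoly.smulVec {m : ℕ} (f : PwPoly m) (v : Plane) : PwField m :=
  fun j i => f j * MvPolynomial.C (v i)

namespace NodalPatch

variable {m : ℕ} (K : NodalPatch m)

/-- The piecewise affine nodal basis function of the vertex `z`. -/
def phiZ : PwPoly m := fun j => bary K.z (K.P j) (K.P (j + 1))

/-- The piecewise affine nodal basis function of the vertex `P k`. -/
def phi (k : ZMod m) : PwPoly m := fun j =>
  if j = k then bary (K.P j) (K.P (j + 1)) K.z
  else if j = k - 1 then bary (K.P (j + 1)) K.z (K.P j)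
  else 0

/-- On a triangle with number `l` that contains the edge `E j` the Crouzeix-Raviart edge function,
written in terms of the nodal basis function of the vertex `P k` opposite to the edge `E j`. -/
def psiLocal (p : ℕ) (j k l : ZMod m) : Poly :=
  MvPolynomial.C (6 / (Polynomial.derivative (legendre p)).eval 1) *
    (Polynomial.aeval (1 - 2 * K.phi k l) (legendre p) +
      MvPolynomial.C (5 * (Polynomial.derivative (legendre p)).eval 1 - 30) *
        (K.phiZ l) ^ 2 * (K.phi j l) ^ 2)

/-- The Crouzeix-Raviart edge function of degree `p` of the edge `E j`, supported on
`T (j - 1) ∪ T j`. -/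
def psi (p : ℕ) (j : ZMod m) : PwPoly m := fun l =>
  if l = j then K.psiLocal p j (j + 1) l
  else if l = j - 1 then K.psiLocal p j (j - 1) l
  else 0

/-- The five edge-oriented vector fields of the edge `E j`. -/
def b (p : ℕ) (ja : ZMod m × Fin 5) : PwField m :=
  ![PwPoly.smulVec (K.phi ja.1 * K.phiZ ^ 2) (K.normal ja.1),
    PwPoly.smulVec (K.phi ja.1 * K.phiZ ^ 2) (K.tangent ja.1),
    PwPoly.smulVec (K.phi ja.1 ^ 2 * K.phiZ) (K.normal ja.1),
    PwPoly.smulVec (K.phi ja.1 ^ 2 * K.phiZ) (K.tangent ja.1),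
    PwPoly.smulVec (K.psi p ja.1) (K.normal ja.1)] ja.2

/-- The four functionals of each triangle `T j`: the values at its vertices `z`, `P j`, `P (j + 1)`
and the integral over `T j`. -/
def Lam (jc : ZMod m × Fin 4) (g : PwPoly m) : ℝ :=
  ![evalAt K.z (g jc.1), evalAt (K.P jc.1) (g jc.1), evalAt (K.P (jc.1 + 1)) (g jc.1),
    triangleIntegral K.z (K.P jc.1) (K.P (jc.1 + 1)) (g jc.1)] jc.2

/-- The `5m × 4m` matrix of the functionals applied to the divergences of the edge-oriented
vector fields. -/
def M (p : ℕ) : Matrix (ZMod m × Fin 5) (ZMod m × Fin 4) ℝ :=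
  Matrix.of fun k j => K.Lam j (divPw m (K.b p k))

/-- The diagonal left scaling matrix. -/
def DL : Matrix (ZMod m × Fin 5) (ZMod m × Fin 5) ℝ :=
  Matrix.diagonal fun ja =>
    ![K.edgeLength ja.1, -K.edgeLength ja.1, K.edgeLength ja.1, K.edgeLength ja.1,
      K.edgeLength ja.1 / 12] ja.2

/-- The diagonal right scaling matrix. -/
def DR : Matrix (ZMod m × Fin 4) (ZMod m × Fin 4) ℝ :=
  Matrix.diagonal fun jc => ![1, 1, 1, 6 / K.area jc.1] jc.2

/-- The scaled matrix `A = D_L M D_R`. -/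
def A [NeZero m] (p : ℕ) : Matrix (ZMod m × Fin 5) (ZMod m × Fin 4) ℝ :=
  K.DL * K.M p * K.DR

/-- The vector `s = (0, 0, 0, 1, 0, 0, 0, 1, …, 0, 0, 0, 1)` of the constant pressure. -/
def s (_K : NodalPatch m) : ZMod m × Fin 4 → ℝ := fun jc => ![0, 0, 0, 1] jc.2

/-- The vector `v₀ = (0, 0, 0, |T 1|, …, 0, 0, 0, |T m|)`. -/
def v0 : ZMod m × Fin 4 → ℝ := fun jc => ![0, 0, 0, K.area jc.1] jc.2

/-- The Crouzeix-Raviart space of degree `p` on the patch: piecewise polynomial vector fields of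
degree at most `p` that are continuous at the Gauss points of the interior edges `E j` and vanish
at the Gauss points of the boundary edges `conv {P j, P (j + 1)}`. -/
def CR (p : ℕ) : Submodule ℝ (PwField m) where
  carrier := {v | v ∈ PwFieldLE m p ∧
    (∀ j, ∀ x ∈ gaussPoints p K.z (K.P j), ∀ i, evalAt x (v (j - 1) i) = evalAt x (v j i)) ∧
    (∀ j, ∀ x ∈ gaussPoints p (K.P j) (K.P (j + 1)), ∀ i, evalAt x (v j i) = 0)}
  zero_mem' := ⟨Submodule.zero_mem _, by simp, by simp [evalAt]⟩
  add_mem' := by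
    rintro v w ⟨hv, hv1, hv2⟩ ⟨hw, hw1, hw2⟩
    refine ⟨Submodule.add_mem _ hv hw, fun j x hx i => ?_, fun j x hx i => ?_⟩
    · have h1 := hv1 j x hx i
      have h2 := hw1 j x hx i
      simp_all [evalAt]
    · have h1 := hv2 j x hx i
      have h2 := hw2 j x hx i
      simp_all [evalAt]
  smul_mem' := by
    rintro c v ⟨hv, hv1, hv2⟩
    refine ⟨Submodule.smul_mem _ c hv, fun j x hx i => ?_, fun j x hx i => ?_⟩
    · have h1 := hv1 j x hx i
      simp_all [evalAt, MvPolynomial.smul_eval]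
    · have h1 := hv2 j x hx i
      simp_all [evalAt, MvPolynomial.smul_eval]

/-- The space `V(z)` spanned by the `5m` edge-oriented vector fields. -/
def V (p : ℕ) : Submodule ℝ (PwField m) := Submodule.span ℝ (Set.range (K.b p))

/-- The piecewise bubble functions: vector fields of degree at most `p` on each triangle that
vanish on the boundary of each triangle. -/
def Bubble (p : ℕ) : Submodule ℝ (PwField m) where
  carrier := {v | v ∈ PwFieldLE m p ∧
    ∀ j, ∀ x ∈ triangleBoundary K.z (K.P j) (K.P (j + 1)), ∀ i, evalAt x (v j i) = 0}
  zero_mem' := ⟨Submodule.zero_mem _, by simp [evalAt]⟩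
  add_mem' := by
    rintro v w ⟨hv, hv1⟩ ⟨hw, hw1⟩
    refine ⟨Submodule.add_mem _ hv hw, fun j x hx i => ?_⟩
    have h1 := hv1 j x hx i
    have h2 := hw1 j x hx i
    simp_all [evalAt]
  smul_mem' := by
    rintro c v ⟨hv, hv1⟩
    refine ⟨Submodule.smul_mem _ c hv, fun j x hx i => ?_⟩
    have h1 := hv1 j x hx i
    simp_all [evalAt, MvPolynomial.smul_eval]

/-- The integral of a piecewise polynomial over the patch. -/
def patchIntegral [NeZero m] : PwPoly m →ₗ[ℝ] ℝ :=
  ∑ j, triangleIntegral K.z (K.P j) (K.P (j + 1)) ∘ₗ LinearMap.proj j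

/-- The pressure space: piecewise polynomials of degree at most `k` with vanishing integral. -/
def Pressure [NeZero m] (k : ℕ) : Submodule ℝ (PwPoly m) :=
  PwPolyLE m k ⊓ LinearMap.ker K.patchIntegral

end NodalPatch

end CrouzeixRaviart

end

/-! Everything rests on one fact, `mulVec_M_eq_zero_iff`: a combination of the functionals `Lam`
that annihilates the divergences of all `b` is a multiple of the patch integral.

Kernel. Let a_j, b_j, y_j be the weights of the value at z, the value at P_j and the integral on
T_j; let D_j be twice the area of T_j, r_j = 1/D_j, σ_j = `cotSum` and τ_j = r_j + r_{j-1} - σ_j.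
The tangential rows give a_{j+1} = -a_j and identify the weight at P_{j+1} on T_j with -b_{j+1}. The
cubic normal rows become σ_j a_j = τ_j b_j = -(y_j - y_{j-1})/12, and the row of `psi` becomes a
cyclic second-order difference equation. An energy argument (`cyclic_system_eq_zero`) yields ∑ r_j
((b_{j+1} - b_j)² + (a_{j+1} + b_{j+1} - a_j - b_j)²) = 0, so a and b are constant, and a = 0
because it alternates in sign. If τ_j = 0, then P_{j-1}, P_j, P_{j+1} are collinear; this cannot
hold all around a closed polygon (`exists_cotSum_ne`), so b = 0 and y is constant. The kernel of `A`
follows by diagonal scaling.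

Surjectivity. By duality the rows of `M` span the annihilator of `s`. Hence for every g of mean zero
some v in `V` has a divergence with the same vertex values and triangle integrals as g. The
remainder is treated on each triangle separately: a polynomial of degree at least 2 is, modulo
divergences of bubbles, a combination of the three barycentric coordinates and one product of two of
them, and the four functionals detect these coefficients (`exists_bubble_polyDiv_eq`).

Directness. A bubble has no trace on the edges E_j, whereas the traces of the fields `b` on these
edges determine all coefficients. -/

noncomputable section

namespace CrouzeixRaviart

/-! ### Evaluation of polynomials -/

section Evaluation

variable (x : Plane) (q r : Poly)

@[simp] lemma evalAt_zero : evalAt x 0 = 0 := map_zero _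
@[simp] lemma evalAt_one : evalAt x 1 = 1 := map_one _
@[simp] lemma evalAt_add : evalAt x (q + r) = evalAt x q + evalAt x r := map_add _ _ _
@[simp] lemma evalAt_sub : evalAt x (q - r) = evalAt x q - evalAt x r := map_sub _ _ _
@[simp] lemma evalAt_neg : evalAt x (-q) = -evalAt x q := map_neg _ _
@[simp] lemma evalAt_mul : evalAt x (q * r) = evalAt x q * evalAt x r := map_mul _ _ _
@[simp] lemma evalAt_pow (n : ℕ) : evalAt x (q ^ n) = evalAt x q ^ n := map_pow _ _ _
@[simp] lemma evalAt_C (c : ℝ) : evalAt x (MvPolynomial.C c) = c := MvPolynomial.eval_C c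
@[simp] lemma evalAt_X (i : Fin 2) : evalAt x (MvPolynomial.X i) = x i := MvPolynomial.eval_X i
@[simp] lemma evalAt_smul (c : ℝ) : evalAt x (c • q) = c * evalAt x q :=
  MvPolynomial.smul_eval _ _ _
@[simp] lemma evalAt_sum {ι : Type*} (s : Finset ι) (f : ι → Poly) :
    evalAt x (∑ i ∈ s, f i) = ∑ i ∈ s, evalAt x (f i) := map_sum _ _ _
@[simp] lemma evalAt_two : evalAt x 2 = 2 := map_ofNat (MvPolynomial.eval fun i => x i) 2

lemma evalAt_aeval (f : Polynomial ℝ) :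
    evalAt x (Polynomial.aeval q f) = f.eval (evalAt x q) := by
  have := Polynomial.aeval_algHom_apply (MvPolynomial.aeval (fun i => x i) : Poly →ₐ[ℝ] ℝ) q f
  rw [← Polynomial.coe_aeval_eq_eval]
  unfold evalAt
  rw [← MvPolynomial.coe_aeval_eq_eval]
  exact this.symm

lemma continuous_evalAt : Continuous fun x : Plane => evalAt x q := by
  unfold evalAt
  exact (MvPolynomial.continuous_eval q).comp (by fun_prop)

end Evaluation

/-! ### Barycentric coordinates -/

section Barycentric

variable (A B C : Plane)

lemma orient_rotate : orient B C A = orient A B C := by unfold orient; ring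

lemma orient_rotate_two : orient C A B = orient A B C := by unfold orient; ring

lemma orient_swap : orient A C B = -orient A B C := by unfold orient; ring

lemma bary_swap : bary A C B = bary A B C := by
  unfold bary
  rw [orient_swap, inv_neg, map_neg]
  ring

lemma evalAt_bary (x : Plane) : evalAt x (bary A B C) = (orient A B C)⁻¹ * orient x B C := by
  simp [bary, orient]

/-- The point with affine coordinates `s` and `t` in the frame `A`, `B - A`, `C - A`. -/
def framePoint (s t : ℝ) : Plane := A + s • (B - A) + t • (C - A)

@[simp] lemma framePoint_apply (s t : ℝ) (i : Fin 2) :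
    framePoint A B C s t i = A i + s * (B i - A i) + t * (C i - A i) := by
  simp [framePoint]

lemma framePoint_zero_zero : framePoint A B C 0 0 = A := by simp [framePoint]
lemma framePoint_one_zero : framePoint A B C 1 0 = B := by simp [framePoint]
lemma framePoint_zero_one : framePoint A B C 0 1 = C := by simp [framePoint]

variable {A B C}

lemma evalAt_framePoint_bary_fst (h : orient A B C ≠ 0) (s t : ℝ) :
    evalAt (framePoint A B C s t) (bary A B C) = 1 - s - t := by
  rw [evalAt_bary, inv_mul_eq_iff_eq_mul₀ h]
  simp only [orient, framePoint_apply]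
  ring

lemma evalAt_framePoint_bary_snd (h : orient A B C ≠ 0) (s t : ℝ) :
    evalAt (framePoint A B C s t) (bary B C A) = s := by
  rw [evalAt_bary, orient_rotate, inv_mul_eq_iff_eq_mul₀ h]
  simp only [orient, framePoint_apply]
  ring

lemma evalAt_framePoint_bary_trd (h : orient A B C ≠ 0) (s t : ℝ) :
    evalAt (framePoint A B C s t) (bary C A B) = t := by
  rw [evalAt_bary, orient_rotate_two, inv_mul_eq_iff_eq_mul₀ h]
  simp only [orient, framePoint_apply]
  ring

lemma C_inv_mul_C {c : ℝ} (hc : c ≠ 0) :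
    (MvPolynomial.C c⁻¹ : Poly) * MvPolynomial.C c = 1 := by
  rw [← map_mul, inv_mul_cancel₀ hc, map_one]

lemma bary_fst_eq (h : orient A B C ≠ 0) : bary A B C = 1 - bary B C A - bary C A B := by
  rw [← C_inv_mul_C h]
  simp only [bary, orient_rotate]
  simp only [orient, map_sub, map_mul]
  ring

lemma X_eq_bary (h : orient A B C ≠ 0) (i : Fin 2) : (MvPolynomial.X i : Poly) =
    MvPolynomial.C (A i) + MvPolynomial.C (B i - A i) * bary B C A +
      MvPolynomial.C (C i - A i) * bary C A B := by
  have h2 := C_inv_mul_C h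
  simp only [bary, orient_rotate]
  simp only [orient, map_sub, map_mul] at h2 ⊢
  fin_cases i
  · simp only [Fin.zero_eta]
    linear_combination (MvPolynomial.C (A 0) - MvPolynomial.X 0 : Poly) * h2
  · simp only [Fin.mk_one]
    linear_combination (MvPolynomial.C (A 1) - MvPolynomial.X 1 : Poly) * h2

lemma bary_mem (A B C : Plane) : bary A B C ∈ MvPolynomial.restrictTotalDegree (Fin 2) ℝ 1 := by
  have hC : ∀ c : ℝ, (MvPolynomial.C c : Poly) ∈ MvPolynomial.restrictTotalDegree (Fin 2) ℝ 1 :=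
    fun c => by simp [MvPolynomial.mem_restrictTotalDegree]
  have hX : ∀ i, (MvPolynomial.X i : Poly) ∈ MvPolynomial.restrictTotalDegree (Fin 2) ℝ 1 :=
    fun i => by simp [MvPolynomial.mem_restrictTotalDegree]
  have : bary A B C = (orient A B C)⁻¹ • (MvPolynomial.C (B 0 * C 1 - B 1 * C 0) +
      (B 1 - C 1) • MvPolynomial.X 0 + (C 0 - B 0) • MvPolynomial.X 1) := by
    simp only [bary, map_sub, map_mul, MvPolynomial.smul_eq_C_mul]
    ring
  rw [this]
  exact Submodule.smul_mem _ _ (add_mem (add_mem (hC _) (Submodule.smul_mem _ _ (hX _)))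
    (Submodule.smul_mem _ _ (hX _)))

end Barycentric

/-! ### Degree bounds -/

section Degree

lemma mul_mem_degree {a b k : ℕ} {q r : Poly}
    (hq : q ∈ MvPolynomial.restrictTotalDegree (Fin 2) ℝ a)
    (hr : r ∈ MvPolynomial.restrictTotalDegree (Fin 2) ℝ b) (hk : a + b ≤ k) :
    q * r ∈ MvPolynomial.restrictTotalDegree (Fin 2) ℝ k := by
  rw [MvPolynomial.mem_restrictTotalDegree] at *
  exact (MvPolynomial.totalDegree_mul _ _).trans (by omega)

lemma pow_mem_degree {a n k : ℕ} {q : Poly}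
    (hq : q ∈ MvPolynomial.restrictTotalDegree (Fin 2) ℝ a) (hk : n * a ≤ k) :
    q ^ n ∈ MvPolynomial.restrictTotalDegree (Fin 2) ℝ k := by
  rw [MvPolynomial.mem_restrictTotalDegree] at *
  exact (MvPolynomial.totalDegree_pow _ _).trans ((Nat.mul_le_mul_left n hq).trans hk)

lemma C_mem_degree (c : ℝ) (k : ℕ) :
    (MvPolynomial.C c : Poly) ∈ MvPolynomial.restrictTotalDegree (Fin 2) ℝ k := by
  simp [MvPolynomial.mem_restrictTotalDegree]

lemma aeval_mem_degree {k : ℕ} {q : Poly} (f : Polynomial ℝ) (hf : f.natDegree ≤ k)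
    (hq : q ∈ MvPolynomial.restrictTotalDegree (Fin 2) ℝ 1) :
    Polynomial.aeval q f ∈ MvPolynomial.restrictTotalDegree (Fin 2) ℝ k := by
  rw [Polynomial.aeval_eq_sum_range]
  refine Submodule.sum_mem _ fun i hi => Submodule.smul_mem _ _ (pow_mem_degree hq ?_)
  rw [Finset.mem_range] at hi
  omega

lemma pderiv_mem_degree {k : ℕ} {q : Poly} (i : Fin 2)
    (hq : q ∈ MvPolynomial.restrictTotalDegree (Fin 2) ℝ k) :
    MvPolynomial.pderiv i q ∈ MvPolynomial.restrictTotalDegree (Fin 2) ℝ (k - 1) := by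
  rw [MvPolynomial.mem_restrictTotalDegree] at hq
  rw [q.as_sum, map_sum]
  refine Submodule.sum_mem _ fun s hs => ?_
  rw [MvPolynomial.pderiv_monomial, MvPolynomial.mem_restrictTotalDegree]
  have h1 := (MvPolynomial.le_totalDegree hs).trans hq
  rcases Nat.eq_zero_or_pos (s i) with h0 | h0
  · simp [h0]
  refine (MvPolynomial.totalDegree_monomial_le _ _).trans ?_
  have h2 : (s - Finsupp.single i 1) + Finsupp.single i 1 = s :=
    tsub_add_cancel_of_le (by rw [Finsupp.single_le_iff]; omega)
  have h3 := congrArg Finsupp.degree h2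
  rw [map_add, Finsupp.degree_single] at h3
  change Finsupp.degree s ≤ k at h1
  change Finsupp.degree _ ≤ k - 1
  omega

end Degree

/-! ### Directional derivatives and divergence -/

section Derivative

/-- The derivative of polynomials in the direction `w`. -/
def dirDeriv (w : Plane) : Derivation ℝ Poly Poly :=
  (MvPolynomial.C (w 0) : Poly) • MvPolynomial.pderiv 0 +
    (MvPolynomial.C (w 1) : Poly) • MvPolynomial.pderiv 1

lemma dirDeriv_apply (w : Plane) (q : Poly) : dirDeriv w q =
    MvPolynomial.C (w 0) * MvPolynomial.pderiv 0 q +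
      MvPolynomial.C (w 1) * MvPolynomial.pderiv 1 q := by
  simp [dirDeriv]

/-- The divergence of a polynomial vector field. -/
def polyDiv : (Fin 2 → Poly) →ₗ[ℝ] Poly :=
  ∑ i, (MvPolynomial.pderiv i).toLinearMap ∘ₗ LinearMap.proj i

lemma polyDiv_apply (v : Fin 2 → Poly) :
    polyDiv v = ∑ i, MvPolynomial.pderiv i (v i) := by
  simp [polyDiv]

lemma polyDiv_mul_C (q : Poly) (w : Plane) :
    polyDiv (fun i => q * MvPolynomial.C (w i)) = dirDeriv w q := by
  simp [polyDiv_apply, dirDeriv_apply]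

lemma dirDeriv_add_smul (w v : Plane) (a b : ℝ) (q : Poly) :
    dirDeriv (a • w + b • v) q = a • dirDeriv w q + b • dirDeriv v q := by
  simp only [dirDeriv_apply, PiLp.add_apply, PiLp.smul_apply, smul_eq_mul, map_add, map_mul,
    MvPolynomial.smul_eq_C_mul]
  ring

lemma dirDeriv_aeval (w : Plane) (q : Poly) (f : Polynomial ℝ) :
    dirDeriv w (Polynomial.aeval q f) =
      Polynomial.aeval q (Polynomial.derivative f) * dirDeriv w q := by
  rw [Derivation.map_aeval]; simp

lemma dirDeriv_bary (A B C w : Plane) : dirDeriv w (bary A B C) =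
    MvPolynomial.C ((orient A B C)⁻¹ * (w 0 * (B 1 - C 1) + w 1 * (C 0 - B 0))) := by
  have h01 : MvPolynomial.pderiv (R := ℝ) (0 : Fin 2) (MvPolynomial.X 1) = 0 :=
    MvPolynomial.pderiv_X_of_ne (by decide)
  have h10 : MvPolynomial.pderiv (R := ℝ) (1 : Fin 2) (MvPolynomial.X 0) = 0 :=
    MvPolynomial.pderiv_X_of_ne (by decide)
  simp only [bary, dirDeriv_apply, Derivation.leibniz, map_sub, MvPolynomial.pderiv_C,
    MvPolynomial.pderiv_X_self, h01, h10, smul_eq_mul, map_mul, map_add]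
  ring

variable {A B C : Plane}

lemma dirDeriv_bary_snd (h : orient A B C ≠ 0) (a b : ℝ) :
    dirDeriv (a • (B - A) + b • (C - A)) (bary B C A) = MvPolynomial.C a := by
  rw [dirDeriv_bary, orient_rotate]
  congr 1
  rw [inv_mul_eq_iff_eq_mul₀ h]
  simp [orient]
  ring

lemma dirDeriv_bary_trd (h : orient A B C ≠ 0) (a b : ℝ) :
    dirDeriv (a • (B - A) + b • (C - A)) (bary C A B) = MvPolynomial.C b := by
  rw [dirDeriv_bary, orient_rotate_two]
  congr 1
  rw [inv_mul_eq_iff_eq_mul₀ h]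
  simp [orient]
  ring

lemma dirDeriv_bary_fst (h : orient A B C ≠ 0) (a b : ℝ) :
    dirDeriv (a • (B - A) + b • (C - A)) (bary A B C) = MvPolynomial.C (-a - b) := by
  rw [bary_fst_eq h, map_sub, map_sub, dirDeriv_bary_snd h, dirDeriv_bary_trd h]
  simp

end Derivative

end CrouzeixRaviart

/-! ### Integration over triangles and the divergence theorem -/

namespace CrouzeixRaviart

/-- The reference triangle. -/
def refTriangle : Set (ℝ × ℝ) := {x | 0 ≤ x.1 ∧ 0 ≤ x.2 ∧ x.1 + x.2 ≤ 1}

lemma isCompact_refTriangle : IsCompact refTriangle := by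
  refine (isCompact_Icc (a := ((0 : ℝ), (0 : ℝ))) (b := (1, 1))).of_isClosed_subset ?_ ?_
  · exact (isClosed_le continuous_const continuous_fst).inter
      ((isClosed_le continuous_const continuous_snd).inter
        (isClosed_le (continuous_fst.add continuous_snd) continuous_const))
  · rintro ⟨s, t⟩ ⟨h1, h2, h3⟩
    simp only at h1 h2 h3
    exact ⟨⟨h1, h2⟩, ⟨by simp; linarith, by simp; linarith⟩⟩

lemma triangle_eq_image (A B C : Plane) :
    triangle A B C = (fun x : ℝ × ℝ => framePoint A B C x.1 x.2) '' refTriangle := by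
  ext x
  rw [triangle, convexHull_insert (by simp), convexHull_pair]
  simp only [mem_convexJoin, Set.mem_singleton_iff, exists_eq_left, Set.mem_image]
  constructor
  · rintro ⟨y, ⟨a, b, ha, hb, hab, rfl⟩, c, d, hc, hd, hcd, rfl⟩
    refine ⟨(d * a, d * b), ⟨by positivity, by positivity, ?_⟩, ?_⟩
    · simp only; rw [← mul_add, hab]; linarith
    · ext i
      simp only [framePoint_apply, PiLp.add_apply, PiLp.smul_apply, smul_eq_mul]
      linear_combination (A i) * (-hcd - d * hab)
  · rintro ⟨⟨s, t⟩, ⟨h1, h2, h3⟩, rfl⟩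
    simp only at h1 h2 h3
    rcases eq_or_ne (s + t) 0 with h0 | h0
    · have hs : s = 0 := by linarith
      have ht : t = 0 := by linarith
      subst hs ht
      exact ⟨B, left_mem_segment _ _ _, by rw [framePoint_zero_zero]; exact left_mem_segment _ _ _⟩
    · refine ⟨(s / (s + t)) • B + (t / (s + t)) • C, ⟨_, _, by positivity, by positivity,
        by field_simp, rfl⟩, 1 - (s + t), s + t, by linarith, by positivity, by ring, ?_⟩
      ext i
      simp only [framePoint_apply, PiLp.add_apply, PiLp.smul_apply, smul_eq_mul]
      field_simp
      ring

/-- The linear part of the frame map in coordinates. -/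
def frameLin (A B C : Plane) : ℝ × ℝ →L[ℝ] ℝ × ℝ :=
  ((B 0 - A 0) • ContinuousLinearMap.fst ℝ ℝ ℝ +
    (C 0 - A 0) • ContinuousLinearMap.snd ℝ ℝ ℝ).prod
  ((B 1 - A 1) • ContinuousLinearMap.fst ℝ ℝ ℝ +
    (C 1 - A 1) • ContinuousLinearMap.snd ℝ ℝ ℝ)

lemma det_frameLin (A B C : Plane) : (frameLin A B C).det = orient A B C := by
  rw [ContinuousLinearMap.det, ← LinearMap.det_toMatrix (Module.Basis.finTwoProd ℝ),
    Matrix.det_fin_two]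
  simp [LinearMap.toMatrix_apply, frameLin, orient]
  ring

/-- The measure preserving identification of the plane with pairs of coordinates. -/
def coordEquiv : Plane ≃ᵐ ℝ × ℝ :=
  (MeasurableEquiv.toLp 2 (Fin 2 → ℝ)).symm.trans MeasurableEquiv.finTwoArrow

lemma coordEquiv_apply (x : Plane) : coordEquiv x = (x 0, x 1) := rfl

lemma measurePreserving_coordEquiv : MeasurePreserving coordEquiv volume volume :=
  (EuclideanSpace.volume_preserving_symm_measurableEquiv_toLp (Fin 2)).trans
    (volume_preserving_finTwoArrow ℝ)

lemma integral_triangle {A B C : Plane} (h : orient A B C ≠ 0) (g : Plane → ℝ) :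
    ∫ x in triangle A B C, g x =
      |orient A B C| * ∫ x in refTriangle, g (framePoint A B C x.1 x.2) := by
  set F : ℝ × ℝ → ℝ × ℝ := fun x => coordEquiv (framePoint A B C x.1 x.2) with hF
  have hFx : ∀ x, F x = (A 0, A 1) + frameLin A B C x := by
    intro x
    simp only [hF, coordEquiv_apply, framePoint_apply, frameLin]
    ext <;> simp <;> ring
  have hsymm : ∀ x, coordEquiv.symm (F x) = framePoint A B C x.1 x.2 := fun x =>
    coordEquiv.symm_apply_apply _
  have hT : triangle A B C = coordEquiv ⁻¹' (F '' refTriangle) := by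
    rw [triangle_eq_image, hF, ← Set.image_image coordEquiv,
      Set.preimage_image_eq _ coordEquiv.injective]
  have hd : ∀ x ∈ refTriangle, HasFDerivWithinAt F (frameLin A B C) refTriangle x := by
    intro x _
    have : F = fun x => (A 0, A 1) + frameLin A B C x := funext hFx
    rw [this]
    exact ((frameLin A B C).hasFDerivAt.const_add _).hasFDerivWithinAt
  have hinj : Set.InjOn F refTriangle := by
    intro x _ y _ hxy
    rw [hFx, hFx, add_right_inj] at hxy
    have hu : IsUnit (LinearMap.det (frameLin A B C : ℝ × ℝ →ₗ[ℝ] ℝ × ℝ)) := by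
      have := det_frameLin A B C
      rw [ContinuousLinearMap.det] at this
      rw [this]
      exact h.isUnit
    exact (LinearMap.equivOfDetNeZero _ hu.ne_zero).injective hxy
  have hm := measurePreserving_coordEquiv.setIntegral_preimage_emb
    coordEquiv.measurableEmbedding (fun y => g (coordEquiv.symm y)) (F '' refTriangle)
  simp only [MeasurableEquiv.symm_apply_apply] at hm
  rw [hT, hm, integral_image_eq_integral_abs_det_fderiv_smul volume
    isCompact_refTriangle.measurableSet hd hinj]
  simp only [hsymm, det_frameLin, smul_eq_mul, integral_const_mul]

lemma integral_refTriangle {f : ℝ × ℝ → ℝ} (hf : Continuous f) :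
    ∫ x in refTriangle, f x = ∫ t in (0 : ℝ)..1, ∫ s in (0 : ℝ)..(1 - t), f (s, t) := by
  have hint : Integrable (refTriangle.indicator f) (volume.prod volume) := by
    rw [integrable_indicator_iff isCompact_refTriangle.measurableSet]
    exact hf.continuousOn.integrableOn_compact isCompact_refTriangle
  rw [← integral_indicator isCompact_refTriangle.measurableSet, Measure.volume_eq_prod,
    integral_prod_symm _ hint, intervalIntegral.integral_of_le zero_le_one,
    ← integral_Icc_eq_integral_Ioc, ← integral_indicator measurableSet_Icc]
  congr 1
  ext t
  by_cases ht : t ∈ Set.Icc (0 : ℝ) 1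
  · rw [Set.indicator_of_mem ht, intervalIntegral.integral_of_le (by linarith [ht.2]),
      ← integral_Icc_eq_integral_Ioc, ← integral_indicator measurableSet_Icc]
    congr 1
    ext s
    simp only [Set.indicator, refTriangle, Set.mem_ofPred_eq, Set.mem_Icc]
    congr 1
    simp only [ht.1, true_and, eq_iff_iff]
    constructor <;> rintro ⟨h1, h2⟩ <;> exact ⟨h1, by linarith⟩
  · rw [Set.indicator_of_notMem ht]
    refine integral_eq_zero_of_ae (ae_of_all _ fun s => ?_)
    simp only [Set.indicator, refTriangle, Set.mem_ofPred_eq, Pi.zero_apply]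
    refine if_neg ?_
    rintro ⟨h1, h2, h3⟩
    exact ht ⟨h2, by linarith⟩

lemma hasDerivAt_evalAt_line (x w : Plane) (q : Poly) (s : ℝ) :
    HasDerivAt (fun s : ℝ => evalAt (x + s • w) q) (evalAt (x + s • w) (dirDeriv w q)) s := by
  induction q using MvPolynomial.induction_on with
  | C a => simpa using hasDerivAt_const s a
  | add q r hq hr => simpa using hq.fun_add hr
  | mul_X q i hq =>
    have h1 : HasDerivAt (fun s : ℝ => evalAt (x + s • w) (MvPolynomial.X i))
        (evalAt (x + s • w) (dirDeriv w (MvPolynomial.X i))) s := by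
      have : dirDeriv w (MvPolynomial.X i) = MvPolynomial.C (w i) := by
        rw [dirDeriv_apply]
        fin_cases i
        · simp
        · simp
      rw [this]
      simpa using ((hasDerivAt_id s).mul_const (w i)).const_add (x i)
    simpa [add_comm, mul_comm] using hq.fun_mul h1

lemma triangleIntegral_apply (A B C : Plane) (q : Poly) :
    triangleIntegral A B C q = ∫ x in triangle A B C, evalAt x q := rfl

lemma triangle_swap (A B C : Plane) : triangle A C B = triangle A B C := by
  unfold triangle
  rw [Set.pair_comm]

lemma triangleIntegral_swap (A B C : Plane) : triangleIntegral A C B = triangleIntegral A B C := by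
  refine LinearMap.ext fun q => ?_
  rw [triangleIntegral_apply, triangleIntegral_apply, triangle_swap]

variable {A B C : Plane}

lemma continuous_evalAt_framePoint (A B C : Plane) (q : Poly) :
    Continuous fun x : ℝ × ℝ => evalAt (framePoint A B C x.1 x.2) q :=
  (continuous_evalAt q).comp (by unfold framePoint; fun_prop)

/-- The fundamental theorem of calculus on each line parallel to AB, which enters the triangle
through AC and leaves it through BC. -/
lemma triangleIntegral_dirDeriv_left (h : orient A B C ≠ 0) (q : Poly) :
    triangleIntegral A B C (dirDeriv (B - A) q) = |orient A B C| * ∫ t in (0 : ℝ)..1,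
      (evalAt (framePoint A B C (1 - t) t) q - evalAt (framePoint A B C 0 t) q) := by
  rw [triangleIntegral_apply, integral_triangle h,
    integral_refTriangle (continuous_evalAt_framePoint A B C _)]
  congr 2
  ext t
  have e : ∀ s, framePoint A B C s t = (A + t • (C - A)) + s • (B - A) := fun s => by
    unfold framePoint; abel
  simp only [e]
  refine intervalIntegral.integral_eq_sub_of_hasDerivAt
    (fun s _ => hasDerivAt_evalAt_line _ _ _ _) (Continuous.intervalIntegrable ?_ _ _)
  exact (continuous_evalAt _).comp (by fun_prop)

/-- The divergence theorem on a triangle. -/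
lemma triangleIntegral_dirDeriv (h : orient A B C ≠ 0) (a b : ℝ) (q : Poly) :
    triangleIntegral A B C (dirDeriv (a • (B - A) + b • (C - A)) q) = |orient A B C| *
      (a * (∫ t in (0 : ℝ)..1,
        (evalAt (framePoint A B C (1 - t) t) q - evalAt (framePoint A B C 0 t) q)) +
      b * (∫ t in (0 : ℝ)..1,
        (evalAt (framePoint A B C t (1 - t)) q - evalAt (framePoint A B C t 0) q))) := by
  -- The derivative along C - A is the previous case with B and C interchanged; neither the triangle
  -- nor the absolute determinant changes.
  have e : ∀ s t, framePoint A C B s t = framePoint A B C t s := fun s t => by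
    unfold framePoint; abel
  have h' : orient A C B ≠ 0 := by rw [orient_swap]; exact neg_ne_zero.2 h
  have h2 := triangleIntegral_dirDeriv_left h' q
  rw [triangleIntegral_swap, orient_swap, abs_neg] at h2
  simp only [e] at h2
  rw [dirDeriv_add_smul, map_add, map_smul, map_smul, triangleIntegral_dirDeriv_left h, h2,
    smul_eq_mul, smul_eq_mul]
  ring

/-- The constant 1 is the derivative of a barycentric coordinate, so the divergence theorem already
yields the area. -/
lemma volume_triangle (h : orient A B C ≠ 0) :
    volume.real (triangle A B C) = |orient A B C| / 2 := by
  have h1 := triangleIntegral_dirDeriv h 1 0 (bary B C A)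
  simp only [dirDeriv_bary_snd h, evalAt_framePoint_bary_snd h] at h1
  rw [triangleIntegral_apply] at h1
  simp only [map_one, evalAt_one, integral_const, smul_eq_mul, mul_one] at h1
  rw [measureReal_restrict_apply_univ] at h1
  rw [h1, one_mul, zero_mul, add_zero]
  simp only [sub_zero]
  rw [intervalIntegral.integral_sub (by simp) (by simp)]
  norm_num [integral_id]
  ring

end CrouzeixRaviart

/-! ### Divergences of bubble fields on one triangle -/

namespace CrouzeixRaviart

variable {A B C : Plane}

lemma framePoint_mem_segment_left {t : ℝ} (ht : t ∈ Set.Icc (0 : ℝ) 1) :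
    framePoint A B C t 0 ∈ segment ℝ A B := by
  rw [segment_eq_image']
  exact ⟨t, ht, by simp [framePoint]⟩

lemma framePoint_mem_segment_right {t : ℝ} (ht : t ∈ Set.Icc (0 : ℝ) 1) :
    framePoint A B C 0 t ∈ segment ℝ C A := by
  rw [segment_symm, segment_eq_image']
  exact ⟨t, ht, by simp [framePoint]⟩

lemma framePoint_mem_segment_opposite {t : ℝ} (ht : t ∈ Set.Icc (0 : ℝ) 1) :
    framePoint A B C (1 - t) t ∈ segment ℝ B C := by
  rw [segment_eq_image']
  exact ⟨t, ht, by simp only [framePoint]; module⟩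

lemma exists_framePoint_of_mem_triangleBoundary {x : Plane} (hx : x ∈ triangleBoundary A B C) :
    ∃ s t, x = framePoint A B C s t ∧ (1 - s - t) * s * t = 0 := by
  rcases hx with (hx | hx) | hx
  · rw [segment_eq_image'] at hx
    obtain ⟨t, -, rfl⟩ := hx
    exact ⟨t, 0, by simp [framePoint], by simp⟩
  · rw [segment_eq_image'] at hx
    obtain ⟨t, -, rfl⟩ := hx
    exact ⟨1 - t, t, by simp only [framePoint]; module, by ring⟩
  · rw [segment_symm, segment_eq_image'] at hx
    obtain ⟨t, -, rfl⟩ := hx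
    exact ⟨0, t, by simp [framePoint], by simp⟩

lemma exists_eq_smul_frame (h : orient A B C ≠ 0) (w : Plane) :
    ∃ a b : ℝ, w = a • (B - A) + b • (C - A) := by
  refine ⟨(w 0 * (C 1 - A 1) - w 1 * (C 0 - A 0)) / orient A B C,
    ((B 0 - A 0) * w 1 - (B 1 - A 1) * w 0) / orient A B C, ?_⟩
  ext i
  simp only [PiLp.add_apply, PiLp.smul_apply, PiLp.sub_apply, smul_eq_mul]
  rw [div_mul_eq_mul_div, div_mul_eq_mul_div, ← add_div, eq_div_iff h]
  unfold orient
  fin_cases i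
  · simp only [Fin.zero_eta]; ring
  · simp only [Fin.mk_one]; ring

/-- Polynomial vector fields of degree at most `k` that vanish on the boundary of a triangle. -/
def triangleBubble (A B C : Plane) (k : ℕ) : Set (Fin 2 → Poly) :=
  {v | (∀ i, v i ∈ MvPolynomial.restrictTotalDegree (Fin 2) ℝ k) ∧
    ∀ x ∈ triangleBoundary A B C, ∀ i, evalAt x (v i) = 0}

lemma triangleIntegral_dirDeriv_eq_zero (h : orient A B C ≠ 0) (w : Plane) {q : Poly}
    (hq : ∀ x ∈ triangleBoundary A B C, evalAt x q = 0) :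
    triangleIntegral A B C (dirDeriv w q) = 0 := by
  obtain ⟨a, b, rfl⟩ := exists_eq_smul_frame h w
  rw [triangleIntegral_dirDeriv h]
  have h1 : ∀ t ∈ Set.uIcc (0 : ℝ) 1, evalAt (framePoint A B C (1 - t) t) q -
      evalAt (framePoint A B C 0 t) q = 0 := by
    intro t ht
    rw [Set.uIcc_of_le zero_le_one] at ht
    rw [hq _ (Or.inl (Or.inr (framePoint_mem_segment_opposite ht))),
      hq _ (Or.inr (framePoint_mem_segment_right ht)), sub_zero]
  have h2 : ∀ t ∈ Set.uIcc (0 : ℝ) 1, evalAt (framePoint A B C t (1 - t)) q -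
      evalAt (framePoint A B C t 0) q = 0 := by
    intro t ht
    rw [Set.uIcc_of_le zero_le_one] at ht
    have := hq _ (Or.inl (Or.inr (framePoint_mem_segment_opposite
      (A := A) (B := B) (C := C) (Set.Icc.one_sub_mem ht))))
    rw [sub_sub_cancel] at this
    rw [this, hq _ (Or.inl (Or.inl (framePoint_mem_segment_left ht))), sub_zero]
  rw [intervalIntegral.integral_congr h1, intervalIntegral.integral_congr h2]
  simp

lemma triangleIntegral_polyDiv_bubble (h : orient A B C ≠ 0) {v : Fin 2 → Poly} {k : ℕ}
    (hv : v ∈ triangleBubble A B C k) : triangleIntegral A B C (polyDiv v) = 0 := by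
  have e : polyDiv v = dirDeriv !₂[1, 0] (v 0) + dirDeriv !₂[0, 1] (v 1) := by
    simp [polyDiv_apply, dirDeriv_apply]
  rw [e, map_add, triangleIntegral_dirDeriv_eq_zero h _ fun x hx => hv.2 x hx 0,
    triangleIntegral_dirDeriv_eq_zero h _ fun x hx => hv.2 x hx 1, add_zero]

/-- The bubble polynomial of a triangle. -/
def bubblePoly (A B C : Plane) : Poly := bary A B C * bary B C A * bary C A B

/-- The span of the directional derivatives of the multiples of the bubble polynomial that have
degree at most `k`. -/
def bubbleDiv (A B C : Plane) (k : ℕ) : Submodule ℝ Poly :=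
  Submodule.span ℝ {r | ∃ w q n, q ∈ MvPolynomial.restrictTotalDegree (Fin 2) ℝ n ∧ n + 3 ≤ k ∧
    r = dirDeriv w (bubblePoly A B C * q)}

lemma bubbleDiv_mono {k l : ℕ} (hkl : k ≤ l) : bubbleDiv A B C k ≤ bubbleDiv A B C l :=
  Submodule.span_mono fun _ ⟨w, q, n, hq, hn, hr⟩ => ⟨w, q, n, hq, hn.trans hkl, hr⟩

lemma bubblePoly_mem (A B C : Plane) :
    bubblePoly A B C ∈ MvPolynomial.restrictTotalDegree (Fin 2) ℝ 3 :=
  mul_mem_degree (mul_mem_degree (bary_mem _ _ _) (bary_mem _ _ _) le_rfl) (bary_mem _ _ _) le_rfl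

lemma evalAt_bubblePoly (h : orient A B C ≠ 0) {x : Plane} (hx : x ∈ triangleBoundary A B C) :
    evalAt x (bubblePoly A B C) = 0 := by
  obtain ⟨s, t, rfl, hst⟩ := exists_framePoint_of_mem_triangleBoundary hx
  simpa [bubblePoly, evalAt_framePoint_bary_fst h, evalAt_framePoint_bary_snd h,
    evalAt_framePoint_bary_trd h] using hst

lemma exists_bubble_of_mem_bubbleDiv (h : orient A B C ≠ 0) {k : ℕ} {r : Poly}
    (hr : r ∈ bubbleDiv A B C k) : ∃ v ∈ triangleBubble A B C k, polyDiv v = r := by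
  induction hr using Submodule.span_induction with
  | mem r hr =>
    obtain ⟨w, q, n, hq, hn, rfl⟩ := hr
    refine ⟨_, ⟨fun i => ?_, fun x hx i => ?_⟩, polyDiv_mul_C _ w⟩
    · exact mul_mem_degree (mul_mem_degree (bubblePoly_mem _ _ _) hq le_rfl)
        (C_mem_degree _ 0) (by omega)
    · simp [evalAt_bubblePoly h hx]
  | zero => exact ⟨0, ⟨fun i => zero_mem _, by simp⟩, map_zero _⟩
  | add r r' _ _ hr hr' =>
    obtain ⟨v, hv, rfl⟩ := hr
    obtain ⟨v', hv', rfl⟩ := hr'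
    refine ⟨v + v', ⟨fun i => add_mem (hv.1 i) (hv'.1 i), fun x hx i => ?_⟩, map_add _ _ _⟩
    simp [hv.2 x hx i, hv'.2 x hx i]
  | smul c r _ hr =>
    obtain ⟨v, hv, rfl⟩ := hr
    refine ⟨c • v, ⟨fun i => Submodule.smul_mem _ _ (hv.1 i), fun x hx i => ?_⟩, map_smul _ _ _⟩
    simp [hv.2 x hx i]

/-- At a vertex two of the three factors of the bubble vanish, so every term of the product rule
retains a vanishing factor. The three hypotheses of `key` single out the vertices. -/
lemma evalAt_bubbleDiv (h : orient A B C ≠ 0) {k : ℕ} {r : Poly} (hr : r ∈ bubbleDiv A B C k) :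
    evalAt A r = 0 ∧ evalAt B r = 0 ∧ evalAt C r = 0 := by
  have key : ∀ s t : ℝ, (1 - s - t) * s = 0 → s * t = 0 → (1 - s - t) * t = 0 →
      evalAt (framePoint A B C s t) r = 0 := by
    intro s t h1 h2 h3
    induction hr using Submodule.span_induction with
    | mem r hr =>
      obtain ⟨w, q, n, hq, hn, rfl⟩ := hr
      simp only [bubblePoly, Derivation.leibniz, smul_eq_mul, evalAt_add, evalAt_mul,
        evalAt_framePoint_bary_fst h, evalAt_framePoint_bary_snd h,
        evalAt_framePoint_bary_trd h]
      linear_combination (t * evalAt (framePoint A B C s t) (dirDeriv w q) +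
          evalAt (framePoint A B C s t) q *
            evalAt (framePoint A B C s t) (dirDeriv w (bary C A B))) * h1 +
        evalAt (framePoint A B C s t) q *
            evalAt (framePoint A B C s t) (dirDeriv w (bary A B C)) * h2 +
        evalAt (framePoint A B C s t) q *
            evalAt (framePoint A B C s t) (dirDeriv w (bary B C A)) * h3
    | zero => simp
    | add r r' _ _ hr hr' => simp [hr, hr']
    | smul c r _ hr => simp [hr]
  refine ⟨?_, ?_, ?_⟩
  · simpa [framePoint_zero_zero] using key 0 0
  · simpa [framePoint_one_zero] using key 1 0
  · simpa [framePoint_zero_one] using key 0 1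

lemma triangleIntegral_bubbleDiv (h : orient A B C ≠ 0) {k : ℕ} {r : Poly}
    (hr : r ∈ bubbleDiv A B C k) : triangleIntegral A B C r = 0 := by
  obtain ⟨v, hv, rfl⟩ := exists_bubble_of_mem_bubbleDiv h hr
  exact triangleIntegral_polyDiv_bubble h hv

/-- The span of the monomials of degree at most `k` in two barycentric coordinates. -/
def baryMonomials (A B C : Plane) (k : ℕ) : Submodule ℝ Poly :=
  Submodule.span ℝ {r | ∃ a b, a + b ≤ k ∧ r = bary B C A ^ a * bary C A B ^ b}

lemma mem_baryMonomials {a b k : ℕ} (hab : a + b ≤ k) :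
    bary B C A ^ a * bary C A B ^ b ∈ baryMonomials A B C k :=
  Submodule.subset_span ⟨a, b, hab, rfl⟩

lemma baryMonomials_mono {k l : ℕ} (hkl : k ≤ l) :
    baryMonomials A B C k ≤ baryMonomials A B C l :=
  Submodule.span_mono fun _ ⟨a, b, hab, hr⟩ => ⟨a, b, hab.trans hkl, hr⟩

lemma baryMonomials_mul_le (k l : ℕ) :
    baryMonomials A B C k * baryMonomials A B C l ≤ baryMonomials A B C (k + l) := by
  unfold baryMonomials
  rw [Submodule.span_mul_span]
  refine Submodule.span_mono ?_
  rintro _ ⟨_, ⟨a, b, hab, rfl⟩, _, ⟨c, d, hcd, rfl⟩, rfl⟩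
  exact ⟨a + c, b + d, by omega, by simp only; ring⟩

lemma baryMonomials_pow_mem {q : Poly} (hq : q ∈ baryMonomials A B C 1) (n : ℕ) :
    q ^ n ∈ baryMonomials A B C n := by
  induction n with
  | zero => simpa using mem_baryMonomials (A := A) (B := B) (C := C) (le_refl (0 + 0))
  | succ n ih =>
    rw [pow_succ]
    exact baryMonomials_mul_le _ _ (Submodule.mul_mem_mul ih hq)

lemma degree_le_baryMonomials (h : orient A B C ≠ 0) (k : ℕ) :
    MvPolynomial.restrictTotalDegree (Fin 2) ℝ k ≤ baryMonomials A B C k := by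
  intro q hq
  rw [MvPolynomial.mem_restrictTotalDegree] at hq
  have hX : ∀ i, (MvPolynomial.X i : Poly) ∈ baryMonomials A B C 1 := by
    intro i
    have h0 := mem_baryMonomials (A := A) (B := B) (C := C) (show 0 + 0 ≤ 1 by norm_num)
    have h1 := mem_baryMonomials (A := A) (B := B) (C := C) (show 1 + 0 ≤ 1 by norm_num)
    have h2 := mem_baryMonomials (A := A) (B := B) (C := C) (show 0 + 1 ≤ 1 by norm_num)
    rw [X_eq_bary h i]
    have := add_mem (add_mem (Submodule.smul_mem _ (A i) h0)
      (Submodule.smul_mem _ (B i - A i) h1)) (Submodule.smul_mem _ (C i - A i) h2)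
    simpa only [MvPolynomial.smul_eq_C_mul, pow_zero, pow_one, mul_one, one_mul] using this
  rw [q.as_sum]
  refine Submodule.sum_mem _ fun s hs => ?_
  have hs' := (MvPolynomial.le_totalDegree hs).trans hq
  rw [Finsupp.sum_fintype _ _ (fun _ => rfl), Fin.sum_univ_two] at hs'
  rw [MvPolynomial.monomial_eq, Finsupp.prod_fintype _ _ (fun _ => pow_zero _), Fin.prod_univ_two,
    ← MvPolynomial.smul_eq_C_mul]
  exact Submodule.smul_mem _ _ (baryMonomials_mono hs' (baryMonomials_mul_le _ _
    (Submodule.mul_mem_mul (baryMonomials_pow_mem (hX 0) _) (baryMonomials_pow_mem (hX 1) _))))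

lemma dirDeriv_bubble_left (h : orient A B C ≠ 0) (i j : ℕ) :
    dirDeriv (B - A) (bubblePoly A B C * (bary B C A ^ i * bary C A B ^ j)) =
      (i + 1 : ℝ) • (bary B C A ^ i * bary C A B ^ (j + 1)) -
      (i + 2 : ℝ) • (bary B C A ^ (i + 1) * bary C A B ^ (j + 1)) -
      (i + 1 : ℝ) • (bary B C A ^ i * bary C A B ^ (j + 2)) := by
  have h1 : dirDeriv (B - A) (bary B C A) = 1 := by simpa using dirDeriv_bary_snd h 1 0
  have h2 : dirDeriv (B - A) (bary C A B) = 0 := by simpa using dirDeriv_bary_trd h 1 0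
  have e : bubblePoly A B C * (bary B C A ^ i * bary C A B ^ j) =
      (bary B C A ^ (i + 1) - bary B C A ^ (i + 2)) * bary C A B ^ (j + 1) -
        bary B C A ^ (i + 1) * bary C A B ^ (j + 2) := by
    rw [bubblePoly, bary_fst_eq h]; ring
  rw [e]
  simp only [map_sub, Derivation.leibniz, Derivation.leibniz_pow, h1, h2, smul_eq_mul,
    MvPolynomial.smul_eq_C_mul, map_add, map_natCast, map_one, nsmul_eq_mul, Nat.add_sub_cancel,
    Nat.cast_add, Nat.cast_one, Nat.cast_ofNat, map_ofNat]
  rw [show i + 2 - 1 = i + 1 by omega]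
  ring

lemma dirDeriv_bubble_right (h : orient A B C ≠ 0) (i j : ℕ) :
    dirDeriv (C - A) (bubblePoly A B C * (bary B C A ^ i * bary C A B ^ j)) =
      (j + 1 : ℝ) • (bary B C A ^ (i + 1) * bary C A B ^ j) -
      (j + 2 : ℝ) • (bary B C A ^ (i + 1) * bary C A B ^ (j + 1)) -
      (j + 1 : ℝ) • (bary B C A ^ (i + 2) * bary C A B ^ j) := by
  have h1 : dirDeriv (C - A) (bary B C A) = 0 := by simpa using dirDeriv_bary_snd h 0 1
  have h2 : dirDeriv (C - A) (bary C A B) = 1 := by simpa using dirDeriv_bary_trd h 0 1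
  have e : bubblePoly A B C * (bary B C A ^ i * bary C A B ^ j) =
      (bary C A B ^ (j + 1) - bary C A B ^ (j + 2)) * bary B C A ^ (i + 1) -
        bary B C A ^ (i + 2) * bary C A B ^ (j + 1) := by
    rw [bubblePoly, bary_fst_eq h]; ring
  rw [e]
  simp only [map_sub, Derivation.leibniz, Derivation.leibniz_pow, h1, h2, smul_eq_mul,
    MvPolynomial.smul_eq_C_mul, map_add, map_natCast, map_one, nsmul_eq_mul, Nat.add_sub_cancel,
    Nat.cast_add, Nat.cast_one, Nat.cast_ofNat, map_ofNat]
  rw [show j + 2 - 1 = j + 1 by omega]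
  ring

lemma baryMonomial_mem_degree (A B C : Plane) (a b : ℕ) : bary B C A ^ a * bary C A B ^ b ∈
    MvPolynomial.restrictTotalDegree (Fin 2) ℝ (a + b) :=
  mul_mem_degree (pow_mem_degree (bary_mem _ _ _) le_rfl) (pow_mem_degree (bary_mem _ _ _) le_rfl)
    (by omega)

/-- Degree reduction, with X and Y for the barycentric coordinates of B and C. Modulo lower degree,
the two directional derivatives of bubble · X^i Y^j relate neighbouring monomials of degree k + 1.
These relations suffice to eliminate all monomials of that degree. -/
lemma baryMonomial_mem_sup (h : orient A B C ≠ 0) {a b k : ℕ} (hk : 2 ≤ k) (hab : a + b = k + 1) :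
    bary B C A ^ a * bary C A B ^ b ∈ bubbleDiv A B C (k + 2) ⊔ baryMonomials A B C k := by
  set G := bubbleDiv A B C (k + 2) ⊔ baryMonomials A B C k
  have hX : ∀ i j, i + j + 1 = k →
      (i + 2 : ℝ) • (bary B C A ^ (i + 1) * bary C A B ^ (j + 1)) +
        (i + 1 : ℝ) • (bary B C A ^ i * bary C A B ^ (j + 2)) ∈ G := by
    intro i j hij
    have h1 : dirDeriv (B - A) (bubblePoly A B C * (bary B C A ^ i * bary C A B ^ j)) ∈ G :=
      Submodule.mem_sup_left (Submodule.subset_span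
        ⟨_, _, _, baryMonomial_mem_degree _ _ _ i j, by omega, rfl⟩)
    have h2 : (i + 1 : ℝ) • (bary B C A ^ i * bary C A B ^ (j + 1)) ∈ G :=
      Submodule.smul_mem _ _ (Submodule.mem_sup_right (mem_baryMonomials (by omega)))
    rw [dirDeriv_bubble_left h] at h1
    convert sub_mem h2 h1 using 1
    abel
  have hY : ∀ i j, i + j + 1 = k →
      (j + 2 : ℝ) • (bary B C A ^ (i + 1) * bary C A B ^ (j + 1)) +
        (j + 1 : ℝ) • (bary B C A ^ (i + 2) * bary C A B ^ j) ∈ G := by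
    intro i j hij
    have h1 : dirDeriv (C - A) (bubblePoly A B C * (bary B C A ^ i * bary C A B ^ j)) ∈ G :=
      Submodule.mem_sup_left (Submodule.subset_span
        ⟨_, _, _, baryMonomial_mem_degree _ _ _ i j, by omega, rfl⟩)
    have h2 : (j + 1 : ℝ) • (bary B C A ^ (i + 1) * bary C A B ^ j) ∈ G :=
      Submodule.smul_mem _ _ (Submodule.mem_sup_right (mem_baryMonomials (by omega)))
    rw [dirDeriv_bubble_right h] at h1
    convert sub_mem h2 h1 using 1
    abel
  -- Two relations link the same two neighbouring monomials; their determinant is (i+3)(j+3) -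
  -- (i+2)(j+2) = i + j + 5.
  have hE : ∀ i j, i + j + 2 = k → bary B C A ^ (i + 2) * bary C A B ^ (j + 1) ∈ G ∧
      bary B C A ^ (i + 1) * bary C A B ^ (j + 2) ∈ G := by
    intro i j hij
    have h1 := hX (i + 1) j (by omega)
    have h2 := hY i (j + 1) (by omega)
    have h0 : (i + j + 5 : ℝ) ≠ 0 := by positivity
    push_cast at h1 h2
    refine ⟨(Submodule.smul_mem_iff G h0).1 ?_, (Submodule.smul_mem_iff G h0).1 ?_⟩
    · convert sub_mem (Submodule.smul_mem _ (j + 3 : ℝ) h1) (Submodule.smul_mem _ (i + 2 : ℝ) h2)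
        using 1
      simp only [add_assoc, Nat.reduceAdd]
      module
    · convert sub_mem (Submodule.smul_mem _ (i + 3 : ℝ) h2) (Submodule.smul_mem _ (j + 2 : ℝ) h1)
        using 1
      simp only [add_assoc, Nat.reduceAdd]
      module
  have hpos : ∀ i j, i + j + 1 = k → bary B C A ^ (i + 1) * bary C A B ^ (j + 1) ∈ G := by
    intro i j hij
    rcases i with _ | i
    · obtain ⟨j, rfl⟩ : ∃ j', j = j' + 1 := ⟨j - 1, by omega⟩
      exact (hE 0 j (by omega)).2
    · exact (hE i j (by omega)).1
  -- A pure power occurs in one relation together with a mixed monomial, which has just been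
  -- eliminated.
  rcases a with _ | a
  · obtain ⟨j, rfl⟩ : ∃ j, b = j + 2 := ⟨b - 2, by omega⟩
    have := sub_mem (hX 0 j (by omega)) (Submodule.smul_mem _ 2 (hpos 0 j (by omega)))
    simpa using this
  rcases b with _ | b
  · obtain ⟨j, rfl⟩ : ∃ j, a = j + 1 := ⟨a - 1, by omega⟩
    have := sub_mem (hY j 0 (by omega)) (Submodule.smul_mem _ 2 (hpos j 0 (by omega)))
    simpa using this
  exact hpos a b (by omega)

lemma baryMonomials_le_sup (h : orient A B C ≠ 0) {k : ℕ} (hk : 2 ≤ k) :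
    baryMonomials A B C k ≤ bubbleDiv A B C (k + 1) ⊔ baryMonomials A B C 2 := by
  induction k, hk using Nat.le_induction with
  | base => exact le_sup_right
  | succ k hk ih =>
    have ih' : baryMonomials A B C k ≤ bubbleDiv A B C (k + 2) ⊔ baryMonomials A B C 2 :=
      ih.trans (sup_le_sup_right (bubbleDiv_mono (by omega)) _)
    refine Submodule.span_le.2 ?_
    rintro _ ⟨a, b, hab, rfl⟩
    rcases hab.lt_or_eq with hab | hab
    · exact ih' (mem_baryMonomials (by omega))
    · exact (sup_le le_sup_left ih') (baryMonomial_mem_sup h hk hab)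

/-- The two derivatives of the bubble itself are Y - 2XY - Y² and X - 2XY - X², which eliminates the
squares; the constant 1 is the sum of the barycentric coordinates. -/
lemma baryMonomials_two_le (h : orient A B C ≠ 0) : baryMonomials A B C 2 ≤ bubbleDiv A B C 3 ⊔
    Submodule.span ℝ {bary A B C, bary B C A, bary C A B, bary B C A * bary C A B} := by
  set S : Set Poly := {bary A B C, bary B C A, bary C A B, bary B C A * bary C A B}
  set G := bubbleDiv A B C 3 ⊔ Submodule.span ℝ S
  have hS : ∀ r ∈ S, r ∈ G := fun r hr => Submodule.mem_sup_right (Submodule.subset_span hr)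
  have h0 : bary A B C ∈ G := hS _ (by simp [S])
  have h1 : bary B C A ∈ G := hS _ (by simp [S])
  have h2 : bary C A B ∈ G := hS _ (by simp [S])
  have h3 : bary B C A * bary C A B ∈ G := hS _ (by simp [S])
  have hb : ∀ w, dirDeriv w (bubblePoly A B C * (bary B C A ^ 0 * bary C A B ^ 0)) ∈ G :=
    fun w => Submodule.mem_sup_left (Submodule.subset_span
        ⟨_, _, _, baryMonomial_mem_degree _ _ _ 0 0, le_rfl, rfl⟩)
  have h4 := hb (B - A)
  have h5 := hb (C - A)
  rw [dirDeriv_bubble_left h] at h4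
  rw [dirDeriv_bubble_right h] at h5
  simp only [CharP.cast_eq_zero, zero_add, one_smul, pow_zero, one_mul, pow_one, mul_one] at h4 h5
  have h22 : bary C A B ^ 2 ∈ G := by
    convert sub_mem (sub_mem h2 (Submodule.smul_mem _ 2 h3)) h4 using 1
    abel
  have h11 : bary B C A ^ 2 ∈ G := by
    convert sub_mem (sub_mem h1 (Submodule.smul_mem _ 2 h3)) h5 using 1
    abel
  have h00 : (1 : Poly) ∈ G := by
    convert add_mem (add_mem h0 h1) h2 using 1
    rw [bary_fst_eq h]; ring
  refine Submodule.span_le.2 ?_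
  rintro _ ⟨a, b, hab, rfl⟩
  change _ ∈ G
  match a, b, hab with
  | 0, 0, _ => rw [pow_zero, pow_zero, one_mul]; exact h00
  | 0, 1, _ => rw [pow_zero, pow_one, one_mul]; exact h2
  | 0, 2, _ => rw [pow_zero, one_mul]; exact h22
  | 1, 0, _ => rw [pow_zero, pow_one, mul_one]; exact h1
  | 1, 1, _ => rw [pow_one, pow_one]; exact h3
  | 2, 0, _ => rw [pow_zero, mul_one]; exact h11
  | a + 3, b, hab => omega
  | a + 2, b + 1, hab => omega
  | a + 1, b + 2, hab => omega
  | a, b + 3, hab => omega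

lemma triangleIntegral_bary_mul_bary (h : orient A B C ≠ 0) :
    triangleIntegral A B C (bary B C A * bary C A B) = |orient A B C| / 24 := by
  have h1 := triangleIntegral_dirDeriv h 1 0 ((2 : ℝ)⁻¹ • (bary B C A ^ 2 * bary C A B))
  have e : dirDeriv ((1 : ℝ) • (B - A) + (0 : ℝ) • (C - A))
      ((2 : ℝ)⁻¹ • (bary B C A ^ 2 * bary C A B)) = bary B C A * bary C A B := by
    rw [Derivation.map_smul, Derivation.leibniz, Derivation.leibniz_pow, dirDeriv_bary_snd h,
      dirDeriv_bary_trd h]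
    simp only [map_zero, map_one, smul_eq_mul, nsmul_eq_mul,
      MvPolynomial.smul_eq_C_mul]
    have : (MvPolynomial.C (2 : ℝ)⁻¹ : Poly) * 2 = 1 := C_inv_mul_C two_ne_zero
    push_cast
    linear_combination (bary B C A * bary C A B) * this
  rw [e] at h1
  rw [h1]
  simp only [evalAt_smul, evalAt_mul, evalAt_pow, evalAt_framePoint_bary_snd h,
    evalAt_framePoint_bary_trd h]
  rw [zero_mul, add_zero, one_mul, div_eq_mul_inv]
  congr 1
  have : ∀ t : ℝ, 2⁻¹ * ((1 - t) ^ 2 * t) - 2⁻¹ * (0 ^ 2 * t) =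
      2⁻¹ * t - t ^ 2 + 2⁻¹ * t ^ 3 := fun t => by ring
  simp only [this]
  rw [intervalIntegral.integral_add (Continuous.intervalIntegrable (by fun_prop) _ _)
    (Continuous.intervalIntegrable (by fun_prop) _ _), intervalIntegral.integral_sub
    (Continuous.intervalIntegrable (by fun_prop) _ _)
    (Continuous.intervalIntegrable (by fun_prop) _ _)]
  rw [intervalIntegral.integral_const_mul, intervalIntegral.integral_const_mul, integral_id,
    integral_pow, integral_pow]
  norm_num

/-- A polynomial that vanishes at the vertices of a triangle and has vanishing integral over it is
the divergence of a polynomial vector field that vanishes on the boundary. -/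
lemma exists_bubble_polyDiv_eq (h : orient A B C ≠ 0) {k : ℕ} (hk : 2 ≤ k) {f : Poly}
    (hf : f ∈ MvPolynomial.restrictTotalDegree (Fin 2) ℝ k) (hA : evalAt A f = 0)
    (hB : evalAt B f = 0) (hC : evalAt C f = 0) (hI : triangleIntegral A B C f = 0) :
    ∃ v ∈ triangleBubble A B C (k + 1), polyDiv v = f := by
  have h1 : f ∈ bubbleDiv A B C (k + 1) ⊔
      Submodule.span ℝ {bary A B C, bary B C A, bary C A B, bary B C A * bary C A B} :=
    (sup_le le_sup_left ((baryMonomials_two_le h).trans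
      (sup_le_sup_right (bubbleDiv_mono (by omega)) _)))
      (baryMonomials_le_sup h hk (degree_le_baryMonomials h k hf))
  obtain ⟨r, hr, g, hg, rfl⟩ := Submodule.mem_sup.1 h1
  simp only [Submodule.mem_span_insert, Submodule.mem_span_singleton] at hg
  obtain ⟨c0, _, ⟨c1, _, ⟨c2, _, ⟨c3, rfl⟩, rfl⟩, rfl⟩, rfl⟩ := hg
  obtain ⟨rA, rB, rC⟩ := evalAt_bubbleDiv h hr
  have rI := triangleIntegral_bubbleDiv h hr
  have e1 := evalAt_framePoint_bary_fst h
  have e2 := evalAt_framePoint_bary_snd h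
  have e3 := evalAt_framePoint_bary_trd h
  have eA1 := e1 0 0
  have eA2 := e2 0 0
  have eA3 := e3 0 0
  have eB1 := e1 1 0
  have eB2 := e2 1 0
  have eB3 := e3 1 0
  have eC1 := e1 0 1
  have eC2 := e2 0 1
  have eC3 := e3 0 1
  rw [framePoint_zero_zero] at eA1 eA2 eA3
  rw [framePoint_one_zero] at eB1 eB2 eB3
  rw [framePoint_zero_one] at eC1 eC2 eC3
  -- The bubble part and the product of two coordinates vanish at all vertices, so the vertex values
  -- isolate `c0`, `c1`, `c2`. The integral then isolates `c3`.
  have hc0 : c0 = 0 := by simpa [rA, eA1, eA2, eA3] using hA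
  have hc1 : c1 = 0 := by simpa [rB, eB1, eB2, eB3] using hB
  have hc2 : c2 = 0 := by simpa [rC, eC1, eC2, eC3] using hC
  subst hc0 hc1 hc2
  have hc3 : c3 = 0 := by
    simpa [rI, triangleIntegral_bary_mul_bary h, h] using hI
  subst hc3
  simpa using exists_bubble_of_mem_bubbleDiv h hr

end CrouzeixRaviart

/-! ### Legendre polynomials: endpoint values and parity -/

namespace CrouzeixRaviart
open Polynomial

lemma eval_iterate_derivative (f : ℝ[X]) (k : ℕ) (r : ℝ) :
    (derivative^[k] f).eval r = k.factorial * (taylor r f).coeff k := by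
  rw [taylor_coeff, ← factorial_smul_hasseDeriv]
  simp

lemma taylor_one_sq_sub_one_pow (p : ℕ) :
    taylor 1 ((X ^ 2 - 1 : ℝ[X]) ^ p) = X ^ p * (X + C 2) ^ p := by
  rw [taylor_pow, ← mul_pow]
  congr 1
  simp only [taylor_apply, sub_comp, pow_comp, X_comp, one_comp]
  rw [show (C 2 : ℝ[X]) = 2 from rfl, show (C 1 : ℝ[X]) = 1 from rfl]
  ring

/-- In the formula of Rodrigues, (X² - 1)^p becomes X^p (X + 2)^p when expanded about 1, and
derivatives at 1 are read off from its coefficients. -/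
lemma legendre_eval_one (p : ℕ) : (legendre p).eval 1 = 1 := by
  rw [legendre, eval_mul, eval_C, eval_iterate_derivative, taylor_one_sq_sub_one_pow,
    coeff_X_pow_mul', if_pos le_rfl, coeff_X_add_C_pow]
  have : (p.factorial : ℝ) ≠ 0 := by positivity
  simp
  field_simp

lemma derivative_legendre_eval_one (p : ℕ) :
    (derivative (legendre p)).eval 1 = p * (p + 1) / 2 := by
  rw [legendre, derivative_C_mul, ← Function.iterate_succ_apply' derivative p,
    eval_mul, eval_C, eval_iterate_derivative, taylor_one_sq_sub_one_pow,
    coeff_X_pow_mul', if_pos (Nat.le_succ p), coeff_X_add_C_pow, Nat.factorial_succ]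
  have : (p.factorial : ℝ) ≠ 0 := by positivity
  rcases p with _ | p
  · simp
  · simp
    field_simp
    ring

lemma iterate_derivative_comp_neg_X (f : ℝ[X]) (k : ℕ) :
    derivative^[k] (f.comp (-X)) = (-1) ^ k * (derivative^[k] f).comp (-X) := by
  induction k generalizing f with
  | zero => simp
  | succ k ih =>
    rw [Function.iterate_succ_apply, derivative_comp, derivative_neg, derivative_X,
      neg_one_mul, Function.iterate_succ_apply, iterate_derivative_neg, ih, pow_succ]
    ring

/-- An odd number of derivatives of an even polynomial is odd. -/
lemma legendre_comp_neg_X {p : ℕ} (hp : Odd p) : (legendre p).comp (-X) = -legendre p := by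
  have h := iterate_derivative_comp_neg_X ((X ^ 2 - 1 : ℝ[X]) ^ p) p
  rw [hp.neg_one_pow, show ((X ^ 2 - 1 : ℝ[X]) ^ p).comp (-X) = (X ^ 2 - 1) ^ p by simp] at h
  rw [legendre, mul_comp, C_comp]
  linear_combination C ((2 ^ p * (p.factorial : ℝ))⁻¹) * h

lemma legendre_eval_neg {p : ℕ} (hp : Odd p) (x : ℝ) :
    (legendre p).eval (-x) = -(legendre p).eval x := by
  have := congrArg (eval x) (legendre_comp_neg_X hp)
  simpa using this

lemma derivative_legendre_eval_neg {p : ℕ} (hp : Odd p) (x : ℝ) :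
    (derivative (legendre p)).eval (-x) = (derivative (legendre p)).eval x := by
  have := congrArg (fun f => eval x (derivative f)) (legendre_comp_neg_X hp)
  simpa [derivative_comp] using this

lemma natDegree_legendre_le (p : ℕ) : (legendre p).natDegree ≤ p := by
  refine (natDegree_C_mul_le _ _).trans ((natDegree_iterate_derivative _ _).trans ?_)
  have : ((X ^ 2 - 1 : ℝ[X]) ^ p).natDegree ≤ p * 2 :=
    natDegree_pow_le_of_le p (by compute_degree)
  omega

end CrouzeixRaviart

/-! ### Vertex and integral functionals of the edge functions -/

namespace CrouzeixRaviart

lemma dirDeriv_smul (a : ℝ) (w : Plane) (q : Poly) : dirDeriv (a • w) q = a • dirDeriv w q := by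
  simpa using dirDeriv_add_smul w 0 a 0 q

lemma integral_legendre_eq_zero {p : ℕ} (hp : Odd p) :
    ∫ t in (0 : ℝ)..1, (legendre p).eval (1 - 2 * (1 - t)) = 0 := by
  have h1 := intervalIntegral.integral_comp_sub_left (a := 0) (b := 1)
    (fun t : ℝ => (legendre p).eval (1 - 2 * t)) 1
  have h2 : ∀ t : ℝ, (legendre p).eval (1 - 2 * (1 - t)) = -(legendre p).eval (1 - 2 * t) := by
    intro t
    rw [← legendre_eval_neg hp]
    congr 1
    ring
  simp only [sub_self, sub_zero] at h1
  have h3 : ∫ t in (0 : ℝ)..1, (legendre p).eval (1 - 2 * (1 - t)) =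
      -∫ t in (0 : ℝ)..1, (legendre p).eval (1 - 2 * t) := by
    simp only [h2, intervalIntegral.integral_neg]
  linarith

lemma derivative_legendre_eval_one_ne_zero {p : ℕ} (hp : 3 ≤ p) :
    (Polynomial.derivative (legendre p)).eval 1 ≠ 0 := by
  rw [derivative_legendre_eval_one]
  have : (0 : ℝ) < p := by exact_mod_cast (by omega : 0 < p)
  positivity

/-- The Crouzeix-Raviart edge function of the edge `conv {A, B}` on the triangle `A`, `B`, `C`. -/
def edgePoly (p : ℕ) (A B C : Plane) : Poly :=
  MvPolynomial.C (6 / (Polynomial.derivative (legendre p)).eval 1) *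
    (Polynomial.aeval (1 - 2 * bary C A B) (legendre p) +
      MvPolynomial.C (5 * (Polynomial.derivative (legendre p)).eval 1 - 30) *
        bary A B C ^ 2 * bary B C A ^ 2)

/-- A linear combination of the values at the vertices and of the integral over a triangle. -/
def vertexFunctional (A B C : Plane) (x : Fin 3 → ℝ) (y : ℝ) (g : Poly) : ℝ :=
  x 0 * evalAt A g + x 1 * evalAt B g + x 2 * evalAt C g + y * triangleIntegral A B C g

lemma vertexFunctional_swap (A B C : Plane) (x : Fin 3 → ℝ) (y : ℝ) (g : Poly) :
    vertexFunctional A C B x y g = vertexFunctional A B C ![x 0, x 2, x 1] y g := by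
  simp only [vertexFunctional, triangleIntegral_swap A B C, Matrix.cons_val]
  ring

lemma vertexFunctional_smul (A B C : Plane) (x : Fin 3 → ℝ) (y c : ℝ) (g : Poly) :
    vertexFunctional A B C x y (c • g) = c * vertexFunctional A B C x y g := by
  simp only [vertexFunctional, evalAt_smul, map_smul, smul_eq_mul]
  ring

lemma vertexFunctional_zero (A B C : Plane) (x : Fin 3 → ℝ) (y : ℝ) :
    vertexFunctional A B C x y 0 = 0 := by
  simp [vertexFunctional]

variable {A B C : Plane}

lemma vertexFunctional_eq (A B C : Plane) (x : Fin 3 → ℝ) (y : ℝ) (g : Poly) :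
    vertexFunctional A B C x y g = x 0 * evalAt (framePoint A B C 0 0) g +
      x 1 * evalAt (framePoint A B C 1 0) g + x 2 * evalAt (framePoint A B C 0 1) g +
      y * triangleIntegral A B C g := by
  rw [framePoint_zero_zero, framePoint_one_zero, framePoint_zero_one, vertexFunctional]

/-- The gradient of this cubic is nonzero at no vertex other than A. Its trace is nonzero only on
the edge AB, with mean 1/12, and only the transversal component b of the direction contributes flux
there. -/
lemma vertexFunctional_cubic_far (h : orient A B C ≠ 0) (a b : ℝ) (x : Fin 3 → ℝ) (y : ℝ) :
    vertexFunctional A B C x y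
      (dirDeriv (a • (B - A) + b • (C - A)) (bary B C A * bary A B C ^ 2)) =
    x 0 * a - y * |orient A B C| * b / 12 := by
  rw [vertexFunctional_eq, triangleIntegral_dirDeriv h]
  have e1 : ∀ t : ℝ, (1 - t) * (1 - (1 - t) - t) ^ 2 - 0 * (1 - 0 - t) ^ 2 = 0 :=
    fun t => by ring
  have e2 : ∀ t : ℝ, t * (1 - t - (1 - t)) ^ 2 - t * (1 - t - 0) ^ 2 = -t + 2 * t ^ 2 - t ^ 3 :=
    fun t => by ring
  have e3 : ∫ t in (0 : ℝ)..1, (-t + 2 * t ^ 2 - t ^ 3) = -1 / 12 := by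
    rw [intervalIntegral.integral_sub (Continuous.intervalIntegrable (by fun_prop) _ _)
      (Continuous.intervalIntegrable (by fun_prop) _ _), intervalIntegral.integral_add
      (Continuous.intervalIntegrable (by fun_prop) _ _)
      (Continuous.intervalIntegrable (by fun_prop) _ _), intervalIntegral.integral_neg,
      intervalIntegral.integral_const_mul, integral_id, integral_pow, integral_pow]
    norm_num
  simp only [evalAt_mul, evalAt_pow, evalAt_framePoint_bary_fst h, evalAt_framePoint_bary_snd h,
    e1, e2, e3, intervalIntegral.integral_zero, Derivation.leibniz, Derivation.leibniz_pow,
    dirDeriv_bary_fst h, dirDeriv_bary_snd h, smul_eq_mul, nsmul_eq_mul, evalAt_add, evalAt_C,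
    Nat.cast_ofNat]
  norm_num
  ring

/-- As in `vertexFunctional_cubic_far`, except that the gradient now survives only at B, where it is
that of the barycentric coordinate of A. -/
lemma vertexFunctional_cubic_near (h : orient A B C ≠ 0) (a b : ℝ) (x : Fin 3 → ℝ) (y : ℝ) :
    vertexFunctional A B C x y
      (dirDeriv (a • (B - A) + b • (C - A)) (bary B C A ^ 2 * bary A B C)) =
    x 1 * (-a - b) - y * |orient A B C| * b / 12 := by
  rw [vertexFunctional_eq, triangleIntegral_dirDeriv h]
  have e1 : ∀ t : ℝ, (1 - t) ^ 2 * (1 - (1 - t) - t) - 0 ^ 2 * (1 - 0 - t) = 0 :=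
    fun t => by ring
  have e2 : ∀ t : ℝ, t ^ 2 * (1 - t - (1 - t)) - t ^ 2 * (1 - t - 0) = t ^ 3 - t ^ 2 :=
    fun t => by ring
  have e3 : ∫ t in (0 : ℝ)..1, (t ^ 3 - t ^ 2) = -1 / 12 := by
    rw [intervalIntegral.integral_sub (Continuous.intervalIntegrable (by fun_prop) _ _)
      (Continuous.intervalIntegrable (by fun_prop) _ _), integral_pow, integral_pow]
    norm_num
  simp only [evalAt_mul, evalAt_pow, evalAt_framePoint_bary_fst h, evalAt_framePoint_bary_snd h,
    e1, e2, e3, intervalIntegral.integral_zero, Derivation.leibniz, Derivation.leibniz_pow,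
    dirDeriv_bary_fst h, dirDeriv_bary_snd h, smul_eq_mul, nsmul_eq_mul, evalAt_add, evalAt_C,
    Nat.cast_ofNat]
  norm_num
  ring

lemma evalAt_framePoint_edgePoly (h : orient A B C ≠ 0) (p : ℕ) (s t : ℝ) :
    evalAt (framePoint A B C s t) (edgePoly p A B C) =
      6 / (Polynomial.derivative (legendre p)).eval 1 * ((legendre p).eval (1 - 2 * t) +
        (5 * (Polynomial.derivative (legendre p)).eval 1 - 30) * (1 - s - t) ^ 2 * s ^ 2) := by
  simp only [edgePoly, evalAt_mul, evalAt_add, evalAt_C, evalAt_aeval, evalAt_sub, evalAt_one,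
    evalAt_two, evalAt_pow, evalAt_framePoint_bary_fst h, evalAt_framePoint_bary_snd h,
    evalAt_framePoint_bary_trd h]

/-- The edge function has mean 1 on AB and, since p is odd, mean 0 on the other two edges. -/
lemma triangleIntegral_dirDeriv_edgePoly (h : orient A B C ≠ 0) {p : ℕ} (hp : 3 ≤ p)
    (hodd : Odd p) (a b : ℝ) :
    triangleIntegral A B C (dirDeriv (a • (B - A) + b • (C - A)) (edgePoly p A B C)) =
      -|orient A B C| * b := by
  have hL := derivative_legendre_eval_one_ne_zero hp
  rw [triangleIntegral_dirDeriv h]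
  simp only [evalAt_framePoint_edgePoly h]
  set d := (Polynomial.derivative (legendre p)).eval 1
  have e1 : ∀ t : ℝ, 6 / d * ((legendre p).eval (1 - 2 * t) +
      (5 * d - 30) * (1 - (1 - t) - t) ^ 2 * (1 - t) ^ 2) - 6 / d * ((legendre p).eval (1 - 2 * t) +
      (5 * d - 30) * (1 - 0 - t) ^ 2 * 0 ^ 2) = 0 := fun t => by ring
  have e2 : ∀ t : ℝ, 6 / d * ((legendre p).eval (1 - 2 * (1 - t)) +
      (5 * d - 30) * (1 - t - (1 - t)) ^ 2 * t ^ 2) - 6 / d * ((legendre p).eval (1 - 2 * 0) +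
      (5 * d - 30) * (1 - t - 0) ^ 2 * t ^ 2) =
      6 / d * ((legendre p).eval (1 - 2 * (1 - t)) -
        (1 + (5 * d - 30) * (t ^ 2 - 2 * t ^ 3 + t ^ 4))) := fun t => by
    rw [mul_zero, sub_zero, legendre_eval_one]
    ring
  -- Since t²(1 - t)² has integral 1/30, the coefficient 5d - 30 makes this integral d/6, which the
  -- prefactor 6/d normalizes to 1.
  have e3 : ∫ t in (0 : ℝ)..1, (1 + (5 * d - 30) * (t ^ 2 - 2 * t ^ 3 + t ^ 4)) =
      1 + (5 * d - 30) / 30 := by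
    rw [intervalIntegral.integral_add (Continuous.intervalIntegrable (by fun_prop) _ _)
      (Continuous.intervalIntegrable (by fun_prop) _ _), intervalIntegral.integral_const_mul,
      intervalIntegral.integral_add (Continuous.intervalIntegrable (by fun_prop) _ _)
      (Continuous.intervalIntegrable (by fun_prop) _ _),
      intervalIntegral.integral_sub (Continuous.intervalIntegrable (by fun_prop) _ _)
      (Continuous.intervalIntegrable (by fun_prop) _ _), intervalIntegral.integral_const_mul,
      integral_pow, integral_pow, integral_pow]
    norm_num
    ring
  simp only [e1, e2, intervalIntegral.integral_zero, intervalIntegral.integral_const_mul]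
  rw [intervalIntegral.integral_sub (Continuous.intervalIntegrable (by fun_prop) _ _)
      (Continuous.intervalIntegrable (by fun_prop) _ _), integral_legendre_eq_zero hodd, e3]
  field_simp
  ring

/-- The quartic term has zero gradient at every vertex. The Legendre term contributes -12b at each
one, because its derivative is even and takes the same value at 1 and -1. -/
lemma vertexFunctional_edgePoly (h : orient A B C ≠ 0) {p : ℕ} (hp : 3 ≤ p) (hodd : Odd p)
    (a b : ℝ) (x : Fin 3 → ℝ) (y : ℝ) :
    vertexFunctional A B C x y (dirDeriv (a • (B - A) + b • (C - A)) (edgePoly p A B C)) =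
    -12 * b * (x 0 + x 1 + x 2) - y * |orient A B C| * b := by
  have hL := derivative_legendre_eval_one_ne_zero hp
  have hd := derivative_legendre_eval_neg hodd 1
  have e2 : dirDeriv (a • (B - A) + b • (C - A)) (2 : Poly) = 0 := by
    have := Derivation.map_natCast (dirDeriv (a • (B - A) + b • (C - A))) 2
    simpa using this
  rw [vertexFunctional_eq, triangleIntegral_dirDeriv_edgePoly h hp hodd, edgePoly]
  simp only [Derivation.leibniz, dirDeriv_aeval, Derivation.leibniz_pow, map_add, map_sub,
    dirDeriv_bary_fst h, dirDeriv_bary_snd h, dirDeriv_bary_trd h, smul_eq_mul, nsmul_eq_mul,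
    evalAt_add, evalAt_C, evalAt_mul, evalAt_pow, evalAt_framePoint_bary_fst h,
    evalAt_framePoint_bary_snd h, evalAt_framePoint_bary_trd h, Derivation.map_one_eq_zero,
    evalAt_sub, evalAt_zero, evalAt_one, evalAt_aeval, evalAt_two, Nat.cast_ofNat, e2]
  norm_num
  rw [hd]
  set d := (Polynomial.derivative (legendre p)).eval 1
  field_simp
  ring

end CrouzeixRaviart

/-! ### The cyclic difference system -/

namespace CrouzeixRaviart

lemma sum_sub_one_zmod {m : ℕ} [NeZero m] (f : ZMod m → ℝ) : ∑ j, f (j - 1) = ∑ j, f j :=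
  Equiv.sum_comp (Equiv.subRight (1 : ZMod m)) f

lemma eq_of_forall_eq_add_one {m : ℕ} {α : Type*} {f : ZMod m → α} (hf : ∀ j, f (j + 1) = f j)
    (i j : ZMod m) : f i = f j := by
  have h0 : ∀ k : ℤ, f (k : ZMod m) = f 0 := by
    intro k
    induction k with
    | zero => simp
    | succ n ih => push_cast at ih ⊢; rw [hf, ih]
    | pred n ih =>
      push_cast at ih ⊢
      rw [← ih, ← hf, sub_add_cancel]
  obtain ⟨a, rfl⟩ := ZMod.intCast_surjective i
  obtain ⟨b, rfl⟩ := ZMod.intCast_surjective j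
  rw [h0, h0]

/-- A homogeneous cyclic system of difference equations with alternating unknowns `a`. -/
lemma cyclic_system_eq_zero {m : ℕ} [NeZero m] {r a b τ : ZMod m → ℝ} (hr : ∀ j, 0 < r j)
    (ha : ∀ j, a (j + 1) = -a j)
    (h1 : ∀ j, (r j + r (j - 1) - τ j) * a j = τ j * b j)
    (h2 : ∀ j, (r j + r (j - 1)) * b j - r j * b (j + 1) - r (j - 1) * b (j - 1) = -τ j * a j) :
    (∀ j, a j = 0) ∧ (∀ j, b (j + 1) = b j) := by
  have key : ∑ j, (r j * (b (j + 1) - b j) ^ 2 +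
      r j * (a (j + 1) + b (j + 1) - a j - b j) ^ 2) = 0 := by
    have e : ∀ j, a (j - 1) = - a j := fun j => by
      have := ha (j - 1)
      rw [sub_add_cancel] at this
      rw [this, neg_neg]
    -- Summation by parts: subtracting this cyclic quantity from its shift adds zero to the sum and
    -- reduces the claim to an identity for each j.
    have shift := sum_sub_one_zmod fun j => r j * b (j + 1) * (b (j + 1) - b j) +
      r j * (a (j + 1) + b (j + 1)) * (a (j + 1) + b (j + 1) - a j - b j) +
      r j * (b (j + 1) * a j - a (j + 1) * b j)
    rw [← sub_eq_zero.2 shift.symm, ← Finset.sum_sub_distrib]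
    refine Finset.sum_congr rfl fun j _ => ?_
    simp only [sub_add_cancel, ha j, e j]
    -- With these multipliers all terms containing τ cancel.
    linear_combination (2 * b j + 2 * a j) * h2 j + 2 * a j * h1 j
  have key2 : ∀ j, r j * (b (j + 1) - b j) ^ 2 = 0 ∧
      r j * (a (j + 1) + b (j + 1) - a j - b j) ^ 2 = 0 := by
    intro j
    have h3 : ∀ j, 0 ≤ r j * (b (j + 1) - b j) ^ 2 := fun j => by have := hr j; positivity
    have h4 : ∀ j, 0 ≤ r j * (a (j + 1) + b (j + 1) - a j - b j) ^ 2 :=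
      fun j => by have := hr j; positivity
    have := (Finset.sum_eq_zero_iff_of_nonneg fun j _ => add_nonneg (h3 j) (h4 j)).1 key j
      (Finset.mem_univ j)
    constructor <;> linarith [h3 j, h4 j]
  have hb : ∀ j, b (j + 1) = b j := fun j => by
    have := (key2 j).1
    simp only [mul_eq_zero, (hr j).ne', false_or, pow_eq_zero_iff two_ne_zero] at this
    linarith
  refine ⟨fun j => ?_, hb⟩
  -- Since b and a + b are constant, so is a; being also alternating, it vanishes for every parity
  -- of m.
  have := (key2 j).2
  simp only [mul_eq_zero, (hr j).ne', false_or, pow_eq_zero_iff two_ne_zero, ha j, hb j] at this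
  linarith

end CrouzeixRaviart

/-! ### The rows of the matrix M -/

namespace CrouzeixRaviart

/-- The normal vector of the edge `conv {A, B}` with the length of the edge. -/
def edgeNormal (A B : Plane) : Plane := !₂[A 1 - B 1, B 0 - A 0]

/-- The coefficients are minus the cotangent of the angle at A and the squared edge length over the
determinant, with signs according to the orientation. -/
lemma edgeNormal_eq {A B C : Plane} (h : orient A B C ≠ 0) : edgeNormal A B =
    (-((B 0 - A 0) * (C 0 - A 0) + (B 1 - A 1) * (C 1 - A 1)) / orient A B C) • (B - A) +
      (((B 0 - A 0) ^ 2 + (B 1 - A 1) ^ 2) / orient A B C) • (C - A) := by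
  ext i
  simp only [PiLp.add_apply, PiLp.smul_apply, PiLp.sub_apply, smul_eq_mul]
  rw [div_mul_eq_mul_div, div_mul_eq_mul_div, ← add_div, eq_div_iff h]
  unfold orient edgeNormal
  fin_cases i
  · simp; ring
  · simp; ring

namespace NodalPatch

variable {m : ℕ} (K : NodalPatch m)

lemma one_ne_zero_index (K : NodalPatch m) : (1 : ZMod m) ≠ 0 := by
  have h := K.three_le
  have : ((1 : ℕ) : ZMod m) ≠ 0 := by
    rw [Ne, ZMod.natCast_eq_zero_iff]
    exact fun h1 => absurd (Nat.le_of_dvd (by norm_num) h1) (by omega)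
  simpa using this

lemma two_ne_zero_index (K : NodalPatch m) : (1 + 1 : ZMod m) ≠ 0 := by
  have h := K.three_le
  have : ((2 : ℕ) : ZMod m) ≠ 0 := by
    rw [Ne, ZMod.natCast_eq_zero_iff]
    exact fun h1 => absurd (Nat.le_of_dvd (by norm_num) h1) (by omega)
  rw [one_add_one_eq_two]
  simpa using this

lemma sub_one_ne (K : NodalPatch m) (j : ZMod m) : j - 1 ≠ j := by
  simpa using K.one_ne_zero_index

lemma add_one_ne (K : NodalPatch m) (j : ZMod m) : j + 1 ≠ j := by
  simpa using K.one_ne_zero_index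

lemma add_one_ne_sub_one (K : NodalPatch m) (j : ZMod m) : j + 1 ≠ j - 1 := by
  intro h
  apply K.two_ne_zero_index
  linear_combination h

lemma orient_ne (j : ZMod m) : orient K.z (K.P j) (K.P (j + 1)) ≠ 0 :=
  (K.counterclockwise j).ne'

/-- On T_{j-1} the frame z, P_j, P_{j-1} is used although it is clockwise: with z and P_j in the
first two places on both sides of E_j, one set of formulas serves both triangles. -/
lemma orient_prev (j : ZMod m) :
    orient K.z (K.P j) (K.P (j - 1)) = -orient K.z (K.P (j - 1)) (K.P (j - 1 + 1)) := by
  rw [orient_swap, sub_add_cancel]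

lemma orient_prev_ne (j : ZMod m) : orient K.z (K.P j) (K.P (j - 1)) ≠ 0 := by
  rw [orient_prev]
  exact neg_ne_zero.2 (K.orient_ne _)

lemma phiZ_apply (j : ZMod m) : K.phiZ j = bary K.z (K.P j) (K.P (j + 1)) := rfl

lemma phiZ_prev (j : ZMod m) : K.phiZ (j - 1) = bary K.z (K.P j) (K.P (j - 1)) := by
  rw [phiZ_apply, sub_add_cancel, bary_swap]

lemma phi_self (j : ZMod m) : K.phi j j = bary (K.P j) (K.P (j + 1)) K.z := by
  simp [phi]

lemma phi_prev (j : ZMod m) : K.phi j (j - 1) = bary (K.P j) (K.P (j - 1)) K.z := by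
  simp only [phi, if_neg (K.sub_one_ne j), if_true, sub_add_cancel]
  rw [bary_swap]

lemma phi_next (j : ZMod m) : K.phi (j + 1) j = bary (K.P (j + 1)) K.z (K.P j) := by
  simp [phi, (K.add_one_ne j).symm]

lemma phi_prev_prev (j : ZMod m) :
    K.phi (j - 1) (j - 1) = bary (K.P (j - 1)) K.z (K.P j) := by
  rw [phi_self, sub_add_cancel, bary_swap]

lemma phi_of_ne {j l : ZMod m} (h : l ≠ j) (h' : l ≠ j - 1) : K.phi j l = 0 := by
  simp [phi, h, h']

lemma psi_self (p : ℕ) (j : ZMod m) : K.psi p j j = edgePoly p K.z (K.P j) (K.P (j + 1)) := by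
  simp only [psi, if_true, psiLocal, phi_next, phi_self, phiZ_apply, edgePoly]

lemma psi_prev (p : ℕ) (j : ZMod m) :
    K.psi p j (j - 1) = edgePoly p K.z (K.P j) (K.P (j - 1)) := by
  simp only [psi, if_neg (K.sub_one_ne j), if_true, psiLocal, phi_prev, phiZ_prev,
    phi_prev_prev, edgePoly]

lemma psi_of_ne (p : ℕ) {j l : ZMod m} (h : l ≠ j) (h' : l ≠ j - 1) : K.psi p j l = 0 := by
  simp [psi, h, h']

/-- The squared length of the edge with number `j`. -/
def edgeSq (j : ZMod m) : ℝ := (K.P j 0 - K.z 0) ^ 2 + (K.P j 1 - K.z 1) ^ 2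

/-- The cotangent of the angle at `z` of the triangle with number `j`. -/
def cotZ (j : ZMod m) : ℝ :=
  ((K.P j 0 - K.z 0) * (K.P (j + 1) 0 - K.z 0) + (K.P j 1 - K.z 1) * (K.P (j + 1) 1 - K.z 1)) /
    orient K.z (K.P j) (K.P (j + 1))

/-- Twice the area of the triangle with number `j`. -/
def dbl (j : ZMod m) : ℝ := orient K.z (K.P j) (K.P (j + 1))

lemma dbl_pos (j : ZMod m) : 0 < K.dbl j := K.counterclockwise j

lemma edgeSq_pos (j : ZMod m) : 0 < K.edgeSq j := by
  have h := K.dbl_pos j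
  rcases (add_nonneg (sq_nonneg (K.P j 0 - K.z 0)) (sq_nonneg (K.P j 1 - K.z 1))).eq_or_lt
    with h0 | h0
  · have h1 : K.P j 0 - K.z 0 = 0 := by nlinarith [sq_nonneg (K.P j 1 - K.z 1)]
    have h2 : K.P j 1 - K.z 1 = 0 := by nlinarith [sq_nonneg (K.P j 0 - K.z 0)]
    simp [dbl, orient, h1, h2] at h
  · exact h0

lemma edgeLength_sq (j : ZMod m) : K.edgeLength j ^ 2 = K.edgeSq j := by
  rw [edgeLength, EuclideanSpace.norm_sq_eq]
  simp [edgeSq]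
  ring

lemma edgeLength_pos (j : ZMod m) : 0 < K.edgeLength j := by
  have h := K.edgeSq_pos j
  rw [← edgeLength_sq] at h
  exact (norm_nonneg _).lt_of_ne fun h0 => by
    rw [edgeLength, ← h0] at h
    simp at h

/-- The summand with coefficient zero is a placeholder for the second frame vector of whichever
triangle is considered. -/
lemma tangent_eq (j : ZMod m) (a b : Plane) : K.tangent j = (K.edgeLength j)⁻¹ •
    ((-1 : ℝ) • (K.P j - K.z) + (0 : ℝ) • (a - b)) := by
  simp [tangent]

lemma normal_eq (j : ZMod m) : K.normal j = (K.edgeLength j)⁻¹ • edgeNormal K.z (K.P j) := by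
  ext i
  fin_cases i
  · simp [normal, tangent, edgeNormal]
  · simp only [normal, tangent, edgeNormal, PiLp.smul_apply, PiLp.sub_apply, smul_eq_mul]
    simp
    ring

/-- The weights of the point evaluations on the triangle with number `j`. -/
def pointWeights (x : ZMod m × Fin 4 → ℝ) (j : ZMod m) : Fin 3 → ℝ :=
  ![x (j, 0), x (j, 1), x (j, 2)]

/-- The same weights with the order of the outer vertices reversed. -/
def pointWeightsSwap (x : ZMod m × Fin 4 → ℝ) (j : ZMod m) : Fin 3 → ℝ :=
  ![x (j, 0), x (j, 2), x (j, 1)]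

lemma sum_Lam (x : ZMod m × Fin 4 → ℝ) (g : PwPoly m) (l : ZMod m) :
    ∑ c, K.Lam (l, c) g * x (l, c) =
      vertexFunctional K.z (K.P l) (K.P (l + 1)) (pointWeights x l) (x (l, 3)) (g l) := by
  simp only [Lam, vertexFunctional, pointWeights, Fin.sum_univ_four, Matrix.cons_val]
  ring

lemma vertexFunctional_prev (x : ZMod m × Fin 4 → ℝ) (j : ZMod m) (g : Poly) :
    vertexFunctional K.z (K.P (j - 1)) (K.P (j - 1 + 1)) (pointWeights x (j - 1)) (x (j - 1, 3)) g =
      vertexFunctional K.z (K.P j) (K.P (j - 1)) (pointWeightsSwap x (j - 1)) (x (j - 1, 3)) g := by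
  rw [sub_add_cancel, vertexFunctional_swap]
  rfl

lemma divPw_apply_eq (v : PwField m) (l : ZMod m) : divPw m v l = polyDiv (v l) := by
  rw [polyDiv_apply]; rfl

/-- A row of `M` involves only the two triangles at the edge. The factor |E_j| clears the
normalization of the tangent and the normal. -/
lemma mulVec_M_eq [NeZero m] {p : ℕ} {j : ZMod m} {a : Fin 5} {F : PwPoly m} {w u : Plane}
    (hw : w = (K.edgeLength j)⁻¹ • u) (hb : K.b p (j, a) = PwPoly.smulVec F w)
    (hF : ∀ l, l ≠ j → l ≠ j - 1 → F l = 0) (x : ZMod m × Fin 4 → ℝ) :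
    K.edgeLength j * (K.M p).mulVec x (j, a) =
      vertexFunctional K.z (K.P j) (K.P (j + 1)) (pointWeights x j) (x (j, 3))
        (dirDeriv u (F j)) +
      vertexFunctional K.z (K.P j) (K.P (j - 1)) (pointWeightsSwap x (j - 1)) (x (j - 1, 3))
        (dirDeriv u (F (j - 1))) := by
  have h1 : ∀ l, divPw m (K.b p (j, a)) l = (K.edgeLength j)⁻¹ • dirDeriv u (F l) := by
    intro l
    rw [divPw_apply_eq, hb, ← dirDeriv_smul, ← hw, ← polyDiv_mul_C]
    rfl
  have h2 : (K.M p).mulVec x (j, a) = ∑ l, vertexFunctional K.z (K.P l) (K.P (l + 1))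
      (pointWeights x l) (x (l, 3)) ((K.edgeLength j)⁻¹ • dirDeriv u (F l)) := by
    rw [Matrix.mulVec, dotProduct, Fintype.sum_prod_type]
    refine Finset.sum_congr rfl fun l _ => ?_
    rw [← h1, ← sum_Lam]
    rfl
  rw [h2, Finset.sum_eq_add j (j - 1) (K.sub_one_ne j).symm]
  · rw [vertexFunctional_prev, vertexFunctional_smul, vertexFunctional_smul, ← mul_add,
      mul_inv_cancel_left₀ (K.edgeLength_pos j).ne']
  · rintro l - ⟨h3, h4⟩
    rw [hF l h3 h4, map_zero, smul_zero, vertexFunctional_zero]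
  · simp
  · simp

variable (j : ZMod m)

lemma abs_orient (j : ZMod m) : |orient K.z (K.P j) (K.P (j + 1))| = K.dbl j :=
  abs_of_pos (K.dbl_pos j)

lemma abs_orient_prev (j : ZMod m) : |orient K.z (K.P j) (K.P (j - 1))| = K.dbl (j - 1) := by
  rw [orient_prev, abs_neg, abs_orient]

lemma edgeNormal_next : edgeNormal K.z (K.P j) =
    (-K.cotZ j) • (K.P j - K.z) + (K.edgeSq j / K.dbl j) • (K.P (j + 1) - K.z) := by
  rw [edgeNormal_eq (K.orient_ne j), neg_div]
  rfl

lemma edgeNormal_prev : edgeNormal K.z (K.P j) =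
    K.cotZ (j - 1) • (K.P j - K.z) +
      (-(K.edgeSq j / K.dbl (j - 1))) • (K.P (j - 1) - K.z) := by
  rw [edgeNormal_eq (K.orient_prev_ne j), orient_prev, neg_div_neg_eq, div_neg]
  simp only [cotZ, edgeSq, dbl, sub_add_cancel]
  congr 3
  ring

lemma cubic_far_of_ne {l : ZMod m} (h : l ≠ j) (h' : l ≠ j - 1) :
    (K.phi j * K.phiZ ^ 2) l = 0 := by
  rw [Pi.mul_apply, K.phi_of_ne h h', zero_mul]

lemma cubic_near_of_ne {l : ZMod m} (h : l ≠ j) (h' : l ≠ j - 1) :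
    (K.phi j ^ 2 * K.phiZ) l = 0 := by
  rw [Pi.mul_apply, Pi.pow_apply, K.phi_of_ne h h', zero_pow two_ne_zero, zero_mul]

lemma cubic_far_self : (K.phi j * K.phiZ ^ 2) j =
    bary (K.P j) (K.P (j + 1)) K.z * bary K.z (K.P j) (K.P (j + 1)) ^ 2 := by
  rw [Pi.mul_apply, Pi.pow_apply, phi_self, phiZ_apply]

lemma cubic_far_prev : (K.phi j * K.phiZ ^ 2) (j - 1) =
    bary (K.P j) (K.P (j - 1)) K.z * bary K.z (K.P j) (K.P (j - 1)) ^ 2 := by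
  rw [Pi.mul_apply, Pi.pow_apply, phi_prev, phiZ_prev]

lemma cubic_near_self : (K.phi j ^ 2 * K.phiZ) j =
    bary (K.P j) (K.P (j + 1)) K.z ^ 2 * bary K.z (K.P j) (K.P (j + 1)) := by
  rw [Pi.mul_apply, Pi.pow_apply, phi_self, phiZ_apply]

lemma cubic_near_prev : (K.phi j ^ 2 * K.phiZ) (j - 1) =
    bary (K.P j) (K.P (j - 1)) K.z ^ 2 * bary K.z (K.P j) (K.P (j - 1)) := by
  rw [Pi.mul_apply, Pi.pow_apply, phi_prev, phiZ_prev]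

variable [NeZero m] (p : ℕ) (x : ZMod m × Fin 4 → ℝ)

lemma mulVec_M_zero : K.edgeLength j * (K.M p).mulVec x (j, 0) =
    -K.cotZ j * x (j, 0) + K.cotZ (j - 1) * x (j - 1, 0) -
      K.edgeSq j / 12 * (x (j, 3) - x (j - 1, 3)) := by
  have := (K.dbl_pos j).ne'
  have := (K.dbl_pos (j - 1)).ne'
  rw [K.mulVec_M_eq (K.normal_eq j) rfl (fun l => K.cubic_far_of_ne j), cubic_far_self,
    cubic_far_prev]
  conv_lhs => enter [1]; rw [K.edgeNormal_next j]
  conv_lhs => enter [2]; rw [K.edgeNormal_prev j]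
  rw [vertexFunctional_cubic_far (K.orient_ne j), vertexFunctional_cubic_far (K.orient_prev_ne j),
    abs_orient, abs_orient_prev]
  simp only [pointWeights, pointWeightsSwap, Matrix.cons_val]
  field_simp
  ring

lemma mulVec_M_one : K.edgeLength j * (K.M p).mulVec x (j, 1) = -(x (j, 0) + x (j - 1, 0)) := by
  rw [K.mulVec_M_eq (K.tangent_eq j 0 0) rfl (fun l => K.cubic_far_of_ne j), cubic_far_self,
    cubic_far_prev]
  have h (R : Plane) : (-1 : ℝ) • (K.P j - K.z) + (0 : ℝ) • ((0 : Plane) - 0) =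
      (-1 : ℝ) • (K.P j - K.z) + (0 : ℝ) • (R - K.z) := by simp
  conv_lhs => enter [1]; rw [h (K.P (j + 1))]
  conv_lhs => enter [2]; rw [h (K.P (j - 1))]
  rw [vertexFunctional_cubic_far (K.orient_ne j), vertexFunctional_cubic_far (K.orient_prev_ne j)]
  simp only [pointWeights, pointWeightsSwap, Matrix.cons_val]
  ring

lemma mulVec_M_two : K.edgeLength j * (K.M p).mulVec x (j, 2) =
    -(K.edgeSq j / K.dbl j - K.cotZ j) * x (j, 1) +
      (K.edgeSq j / K.dbl (j - 1) - K.cotZ (j - 1)) * x (j - 1, 2) -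
      K.edgeSq j / 12 * (x (j, 3) - x (j - 1, 3)) := by
  have := (K.dbl_pos j).ne'
  have := (K.dbl_pos (j - 1)).ne'
  rw [K.mulVec_M_eq (K.normal_eq j) rfl (fun l => K.cubic_near_of_ne j), cubic_near_self,
    cubic_near_prev]
  conv_lhs => enter [1]; rw [K.edgeNormal_next j]
  conv_lhs => enter [2]; rw [K.edgeNormal_prev j]
  rw [vertexFunctional_cubic_near (K.orient_ne j),
    vertexFunctional_cubic_near (K.orient_prev_ne j), abs_orient, abs_orient_prev]
  simp only [pointWeights, pointWeightsSwap, Matrix.cons_val]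
  field_simp
  ring

lemma mulVec_M_three : K.edgeLength j * (K.M p).mulVec x (j, 3) = x (j, 1) + x (j - 1, 2) := by
  rw [K.mulVec_M_eq (K.tangent_eq j 0 0) rfl (fun l => K.cubic_near_of_ne j), cubic_near_self,
    cubic_near_prev]
  have h (R : Plane) : (-1 : ℝ) • (K.P j - K.z) + (0 : ℝ) • ((0 : Plane) - 0) =
      (-1 : ℝ) • (K.P j - K.z) + (0 : ℝ) • (R - K.z) := by simp
  conv_lhs => enter [1]; rw [h (K.P (j + 1))]
  conv_lhs => enter [2]; rw [h (K.P (j - 1))]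
  rw [vertexFunctional_cubic_near (K.orient_ne j),
    vertexFunctional_cubic_near (K.orient_prev_ne j)]
  simp only [pointWeights, pointWeightsSwap, Matrix.cons_val]
  ring

lemma mulVec_M_four {p : ℕ} (hp : 3 ≤ p) (hodd : Odd p) :
    K.edgeLength j * (K.M p).mulVec x (j, 4) =
    -12 * (K.edgeSq j / K.dbl j) * (x (j, 0) + x (j, 1) + x (j, 2)) +
      12 * (K.edgeSq j / K.dbl (j - 1)) * (x (j - 1, 0) + x (j - 1, 1) + x (j - 1, 2)) -
      K.edgeSq j * (x (j, 3) - x (j - 1, 3)) := by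
  have := (K.dbl_pos j).ne'
  have := (K.dbl_pos (j - 1)).ne'
  rw [K.mulVec_M_eq (K.normal_eq j) rfl (fun l => K.psi_of_ne p), psi_self, psi_prev]
  conv_lhs => enter [1]; rw [K.edgeNormal_next j]
  conv_lhs => enter [2]; rw [K.edgeNormal_prev j]
  rw [vertexFunctional_edgePoly (K.orient_ne j) hp hodd,
    vertexFunctional_edgePoly (K.orient_prev_ne j) hp hodd, abs_orient, abs_orient_prev]
  simp only [pointWeights, pointWeightsSwap, Matrix.cons_val]
  field_simp
  ring

end NodalPatch

end CrouzeixRaviart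

/-! ### The kernels of M and A -/

namespace CrouzeixRaviart
namespace NodalPatch

variable {m : ℕ} (K : NodalPatch m)

/-- The scaled sum of the cotangents of the two angles at `z` next to an edge. -/
def cotSum (j : ZMod m) : ℝ := (K.cotZ j + K.cotZ (j - 1)) / K.edgeSq j

/-- Plane vectors u, v, w satisfy det(u,v) w + det(v,w) u = det(u,w) v. Dividing by det(u,v)
det(v,w) turns the coefficient of v into the sum of the two cotangents over |v|². -/
lemma cotSum_mul (j : ZMod m) (i : Fin 2) : K.cotSum j * (K.P j i - K.z i) =
    (K.P (j - 1) i - K.z i) / K.dbl (j - 1) + (K.P (j + 1) i - K.z i) / K.dbl j := by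
  have h1 := (K.dbl_pos j).ne'
  have h2 := (K.dbl_pos (j - 1)).ne'
  have h3 := (K.edgeSq_pos j).ne'
  unfold cotSum cotZ
  change (_ / K.dbl j + _ / K.dbl (j - 1)) / _ * _ = _
  rw [sub_add_cancel]
  field_simp
  simp only [dbl, orient, edgeSq, sub_add_cancel]
  fin_cases i
  · simp only [Fin.zero_eta]; ring
  · simp only [Fin.mk_one]; ring

/-- If all these numbers vanished, `cotSum_mul` would make the outer edge vectors P_{j+1} - P_j,
divided by the positive D_j, independent of j. Since these edges sum to zero around the polygon, all
of them would vanish, and so would the areas. -/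
lemma exists_cotSum_ne [NeZero m] :
    ∃ j, (K.dbl j)⁻¹ + (K.dbl (j - 1))⁻¹ - K.cotSum j ≠ 0 := by
  by_contra! h
  have hstep (i : Fin 2) (j : ZMod m) :
      (K.P (j + 1 + 1) i - K.P (j + 1) i) / K.dbl (j + 1) = (K.P (j + 1) i - K.P j i) / K.dbl j := by
    have h1 := h (j + 1)
    have h2 := K.cotSum_mul (j + 1) i
    rw [add_sub_cancel_right] at h1 h2
    linear_combination -h2 - (K.P (j + 1) i - K.z i) * h1
  have hconst (i : Fin 2) :=
    eq_of_forall_eq_add_one (f := fun j => (K.P (j + 1) i - K.P j i) / K.dbl j) (hstep i)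
  have hzero (i : Fin 2) : K.P (0 + 1) i - K.P 0 i = 0 := by
    have h1 : ∑ j, (K.P (j + 1) i - K.P j i) = 0 := by
      have := sum_sub_one_zmod fun j => K.P (j + 1) i
      simp only [sub_add_cancel] at this
      rw [Finset.sum_sub_distrib, this, sub_self]
    have h2 : ∀ j, K.P (j + 1) i - K.P j i =
        K.dbl j * ((K.P (0 + 1) i - K.P 0 i) / K.dbl 0) := by
      intro j
      rw [← hconst i j 0, mul_div_cancel₀ _ (K.dbl_pos j).ne']
    rw [Finset.sum_congr rfl fun j _ => h2 j, ← Finset.sum_mul] at h1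
    have h3 : 0 < ∑ j, K.dbl j := Finset.sum_pos (fun j _ => K.dbl_pos j) ⟨0, Finset.mem_univ _⟩
    simpa [h3.ne', (K.dbl_pos 0).ne'] using h1
  have := K.dbl_pos 0
  rw [dbl, orient, sub_eq_zero.1 (hzero 0), sub_eq_zero.1 (hzero 1)] at this
  linarith

lemma area_eq (j : ZMod m) : K.area j = K.dbl j / 2 := by
  rw [area, T, volume_triangle (K.orient_ne j), abs_orient]

lemma area_pos (j : ZMod m) : 0 < K.area j := by
  rw [area_eq]
  exact half_pos (K.dbl_pos j)

variable [NeZero m] {p : ℕ}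

lemma mulVec_M_eq_zero_iff (hp : 3 ≤ p) (hodd : Odd p) (x : ZMod m × Fin 4 → ℝ) :
    (K.M p).mulVec x = 0 ↔ ∃ c : ℝ, c • K.s = x := by
  constructor
  · intro hx
    have q0 (j : ZMod m) := K.mulVec_M_zero j p x
    have q1 (j : ZMod m) := K.mulVec_M_one j p x
    have q2 (j : ZMod m) := K.mulVec_M_two j p x
    have q3 (j : ZMod m) := K.mulVec_M_three j p x
    have q4 (j : ZMod m) := K.mulVec_M_four j x hp hodd
    simp only [hx, Pi.zero_apply, mul_zero] at q0 q1 q2 q3 q4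
    have ha (j : ZMod m) : x (j + 1, 0) = -x (j, 0) := by
      have := q1 (j + 1)
      rw [add_sub_cancel_right] at this
      linarith
    have ha' (j : ZMod m) : x (j - 1, 0) = -x (j, 0) := by linarith [q1 j]
    have hc' (j : ZMod m) : x (j - 1, 2) = -x (j, 1) := by linarith [q3 j]
    have hc (j : ZMod m) : x (j, 2) = -x (j + 1, 1) := by
      have := q3 (j + 1)
      rw [add_sub_cancel_right] at this
      linarith
    have g1 (j : ZMod m) : K.cotSum j * x (j, 0) = -(x (j, 3) - x (j - 1, 3)) / 12 := by
      have h1 := (K.edgeSq_pos j).ne'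
      have := q0 j
      rw [ha'] at this
      unfold cotSum
      field_simp
      linarith
    have g2 (j : ZMod m) : ((K.dbl j)⁻¹ + (K.dbl (j - 1))⁻¹ - K.cotSum j) * x (j, 1) =
        -(x (j, 3) - x (j - 1, 3)) / 12 := by
      have h1 := (K.edgeSq_pos j).ne'
      have := q2 j
      rw [hc'] at this
      unfold cotSum
      rw [← mul_right_inj' h1]
      have h2 : K.edgeSq j * (((K.dbl j)⁻¹ + (K.dbl (j - 1))⁻¹ -
          (K.cotZ j + K.cotZ (j - 1)) / K.edgeSq j) * x (j, 1)) =
          (K.edgeSq j / K.dbl j + K.edgeSq j / K.dbl (j - 1) -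
            (K.cotZ j + K.cotZ (j - 1))) * x (j, 1) := by
        field_simp
      rw [h2]
      linarith
    have g3 (j : ZMod m) : (K.dbl j)⁻¹ * (x (j, 0) + x (j, 1) - x (j + 1, 1)) +
        (K.dbl (j - 1))⁻¹ * (x (j, 0) - x (j - 1, 1) + x (j, 1)) =
        -(x (j, 3) - x (j - 1, 3)) / 12 := by
      have h1 := (K.edgeSq_pos j).ne'
      have := q4 j
      rw [hc', hc, ha'] at this
      rw [← mul_right_inj' h1]
      simp only [div_eq_mul_inv] at this ⊢
      linear_combination this / 12
    -- Equating `g1` with `g2` and with `g3` eliminates the differences of the integral weights.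
    obtain ⟨hA, hB⟩ := cyclic_system_eq_zero (r := fun j => (K.dbl j)⁻¹) (a := fun j => x (j, 0))
      (b := fun j => x (j, 1)) (τ := fun j => (K.dbl j)⁻¹ + (K.dbl (j - 1))⁻¹ - K.cotSum j)
      (fun j => inv_pos.2 (K.dbl_pos j)) ha
      (fun j => by rw [g2, ← g1]; ring) (fun j => by linear_combination g3 j - g1 j)
    have hBc := eq_of_forall_eq_add_one (f := fun j => x (j, 1)) hB
    have hb (j : ZMod m) : x (j, 1) = 0 := by
      -- The constant b is annihilated by every τ_j, hence by one that is nonzero.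
      obtain ⟨i, hi⟩ := K.exists_cotSum_ne
      have h1 := g2 i
      rw [← g1, hA, mul_zero, mul_eq_zero] at h1
      refine (hBc j i).trans ?_
      exact h1.resolve_left hi
    have hy := eq_of_forall_eq_add_one (f := fun j => x (j, 3)) fun j => by
      have h1 := g1 (j + 1)
      rw [hA, mul_zero, add_sub_cancel_right] at h1
      linarith
    refine ⟨x (0, 3), ?_⟩
    ext ⟨j, c⟩
    fin_cases c
    · simp [s, hA j]
    · simp [s, hb j]
    · simp [s, hc j, hb]
    · simpa [s] using hy 0 j
  · rintro ⟨c, rfl⟩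
    rw [Matrix.mulVec_smul]
    suffices h : (K.M p).mulVec K.s = 0 by rw [h, smul_zero]
    ext ⟨j, a⟩
    have hE := (K.edgeLength_pos j).ne'
    rw [← mul_right_inj' hE, Pi.zero_apply, mul_zero]
    fin_cases a
    · exact (K.mulVec_M_zero j p K.s).trans (by simp [s])
    · exact (K.mulVec_M_one j p K.s).trans (by simp [s])
    · exact (K.mulVec_M_two j p K.s).trans (by simp [s])
    · exact (K.mulVec_M_three j p K.s).trans (by simp [s])
    · exact (K.mulVec_M_four j K.s hp hodd).trans (by simp [s])

lemma ker_M (hp : 3 ≤ p) (hodd : Odd p) :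
    LinearMap.ker (K.M p).mulVecLin = Submodule.span ℝ {K.s} := by
  ext x
  rw [LinearMap.mem_ker, Matrix.mulVecLin_apply, K.mulVec_M_eq_zero_iff hp hodd,
    Submodule.mem_span_singleton]

lemma mulVec_A_eq_zero_iff (x : ZMod m × Fin 4 → ℝ) :
    (K.A p).mulVec x = 0 ↔ (K.M p).mulVec (K.DR.mulVec x) = 0 := by
  rw [A, ← Matrix.mulVec_mulVec, ← Matrix.mulVec_mulVec]
  constructor
  · intro h
    ext ⟨j, a⟩
    have h1 := congrFun h (j, a)
    have hE := (K.edgeLength_pos j).ne'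
    rw [DL, Matrix.mulVec_diagonal, Pi.zero_apply, mul_eq_zero] at h1
    refine h1.resolve_left ?_
    fin_cases a <;> simp [hE]
  · intro h
    rw [h, Matrix.mulVec_zero]

lemma ker_A (hp : 3 ≤ p) (hodd : Odd p) :
    LinearMap.ker (K.A p).mulVecLin = Submodule.span ℝ {K.v0} := by
  ext x
  rw [LinearMap.mem_ker, Matrix.mulVecLin_apply, mulVec_A_eq_zero_iff,
    K.mulVec_M_eq_zero_iff hp hodd, Submodule.mem_span_singleton]
  constructor
  · rintro ⟨c, hc⟩
    -- The right scaling 6/|T_j| maps `v0` to 6 times `s`.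
    refine ⟨c / 6, ?_⟩
    ext ⟨j, i⟩
    have h1 := congrFun hc (j, i)
    have hT := (K.area_pos j).ne'
    rw [DR, Matrix.mulVec_diagonal] at h1
    fin_cases i
    · simpa [v0, s] using h1
    · simpa [v0, s] using h1
    · simpa [v0, s] using h1
    · simp only [v0, s, Pi.smul_apply, smul_eq_mul] at h1 ⊢
      simp at h1 ⊢
      rw [h1]
      field_simp
  · rintro ⟨c, rfl⟩
    refine ⟨6 * c, ?_⟩
    ext ⟨j, i⟩
    have hT := (K.area_pos j).ne'
    rw [DR, Matrix.mulVec_diagonal]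
    fin_cases i
    · simp [v0, s]
    · simp [v0, s]
    · simp [v0, s]
    · simp [v0, s]
      field_simp

lemma finrank_ker_A (hp : 3 ≤ p) (hodd : Odd p) :
    Module.finrank ℝ (LinearMap.ker (K.A p).mulVecLin) = 1 := by
  rw [K.ker_A hp hodd]
  refine finrank_span_singleton fun h => ?_
  have h1 := congrFun h (0, 3)
  exact (K.area_pos 0).ne' (by simpa [v0] using h1)

/-- Functionals whose entries with number `3` add up to zero are combinations of rows of `M`. -/
lemma exists_vecMul_M_eq (hp : 3 ≤ p) (hodd : Odd p) {t : ZMod m × Fin 4 → ℝ}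
    (ht : ∑ j, t (j, 3) = 0) : ∃ c, Matrix.vecMul c (K.M p) = t := by
  -- The range of the dual map is the annihilator of the kernel, and the condition on t says exactly
  -- that t annihilates `s`.
  have h1 : dotProductEquiv ℝ _ t ∈ LinearMap.range (K.M p).mulVecLin.dualMap := by
    rw [LinearMap.range_dualMap_eq_dualAnnihilator_ker, Submodule.mem_dualAnnihilator,
      K.ker_M hp hodd]
    intro w hw
    obtain ⟨c, rfl⟩ := Submodule.mem_span_singleton.1 hw
    rw [map_smul, dotProductEquiv_apply_apply]
    simp [dotProduct, Fintype.sum_prod_type, Fin.sum_univ_four, s, ht]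
  obtain ⟨f, hf⟩ := h1
  obtain ⟨c, rfl⟩ := (dotProductEquiv ℝ _).surjective f
  refine ⟨c, (dotProductEquiv ℝ _).injective (hf.symm ▸ LinearMap.ext fun x => ?_)⟩
  simp [Matrix.dotProduct_mulVec]

end NodalPatch
end CrouzeixRaviart

/-! ### Inclusion in the Crouzeix-Raviart space and directness of the sum -/

namespace CrouzeixRaviart

lemma edgePoly_mem {p : ℕ} (hp : 3 ≤ p) (A B C : Plane) :
    edgePoly p A B C ∈ MvPolynomial.restrictTotalDegree (Fin 2) ℝ p := by
  refine mul_mem_degree (a := 0) (b := p) (C_mem_degree _ 0) (add_mem ?_ ?_) (by omega)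
  · refine aeval_mem_degree _ (natDegree_legendre_le p) (sub_mem (C_mem_degree 1 1) ?_)
    have : (2 * bary C A B : Poly) = (2 : ℝ) • bary C A B := by
      rw [MvPolynomial.smul_eq_C_mul]; rfl
    rw [this]
    exact Submodule.smul_mem _ _ (bary_mem _ _ _)
  -- For p = 3 the quartic term would exceed the degree, but L_3'(1) = 6 makes its coefficient zero.
  · rcases hp.eq_or_lt with rfl | hp
    · rw [derivative_legendre_eval_one]
      norm_num
    · refine mul_mem_degree (mul_mem_degree (C_mem_degree _ 0) (pow_mem_degree (a := 1) (k := 2)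
        (bary_mem _ _ _) le_rfl) le_rfl) (pow_mem_degree (a := 1) (k := 2) (bary_mem _ _ _) le_rfl)
        (by omega)

/-- The scalar factors of the five edge-oriented fields in terms of affine coordinates. -/
def edgeVal (p : ℕ) (s t : ℝ) : Fin 5 → ℝ :=
  ![s * (1 - s - t) ^ 2, s * (1 - s - t) ^ 2, s ^ 2 * (1 - s - t), s ^ 2 * (1 - s - t),
    6 / (Polynomial.derivative (legendre p)).eval 1 * ((legendre p).eval (1 - 2 * t) +
        (5 * (Polynomial.derivative (legendre p)).eval 1 - 30) * (1 - s - t) ^ 2 * s ^ 2)]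

/-- Off the edge carrying the field, on the other two sides of the triangle, the cubic and quartic
factors vanish identically and only the Legendre factor remains; it vanishes at the Gauss points. -/
lemma edgeVal_eq_zero {p : ℕ} {s t : ℝ} (hst : (1 - s - t) * s = 0)
    (ht : (legendre p).eval (1 - 2 * t) = 0) (a : Fin 5) : edgeVal p s t a = 0 := by
  have h1 : s * (1 - s - t) ^ 2 = 0 := by linear_combination (1 - s - t) * hst
  have h2 : s ^ 2 * (1 - s - t) = 0 := by linear_combination s * hst
  have h3 (d : ℝ) : d * (1 - s - t) ^ 2 * s ^ 2 = 0 := by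
    linear_combination d * (1 - s - t) * s * hst
  fin_cases a <;> simp [edgeVal, h1, h2, h3, ht]

lemma framePoint_swap (A B C : Plane) (s t : ℝ) :
    framePoint A C B t s = framePoint A B C s t := by
  unfold framePoint
  abel

namespace NodalPatch

variable {m : ℕ} (K : NodalPatch m)

/-- The directions of the five edge-oriented fields. -/
def edgeDir (j : ZMod m) : Fin 5 → Plane :=
  ![K.normal j, K.tangent j, K.normal j, K.tangent j, K.normal j]

/-- The scalar factors of the five edge-oriented fields. -/
def edgeFun (p : ℕ) (j : ZMod m) : Fin 5 → PwPoly m :=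
  ![K.phi j * K.phiZ ^ 2, K.phi j * K.phiZ ^ 2, K.phi j ^ 2 * K.phiZ, K.phi j ^ 2 * K.phiZ,
    K.psi p j]

lemma b_eq (p : ℕ) (j : ZMod m) (a : Fin 5) :
    K.b p (j, a) = PwPoly.smulVec (K.edgeFun p j a) (K.edgeDir j a) := by
  fin_cases a <;> rfl

lemma b_apply (p : ℕ) (j : ZMod m) (a : Fin 5) (l : ZMod m) (i : Fin 2) :
    K.b p (j, a) l i = K.edgeFun p j a l * MvPolynomial.C (K.edgeDir j a i) := by
  rw [b_eq]; rfl

lemma edgeFun_of_ne (p : ℕ) {j l : ZMod m} (h : l ≠ j) (h' : l ≠ j - 1) (a : Fin 5) :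
    K.edgeFun p j a l = 0 := by
  fin_cases a
  · exact K.cubic_far_of_ne j h h'
  · exact K.cubic_far_of_ne j h h'
  · exact K.cubic_near_of_ne j h h'
  · exact K.cubic_near_of_ne j h h'
  · exact K.psi_of_ne p h h'

lemma b_of_ne (p : ℕ) {j l : ZMod m} (h : l ≠ j) (h' : l ≠ j - 1) (a : Fin 5) (i : Fin 2) :
    K.b p (j, a) l i = 0 := by
  rw [b_apply, K.edgeFun_of_ne p h h', zero_mul]

lemma edgeFun_mem {p : ℕ} (hp : 3 ≤ p) (j : ZMod m) (a : Fin 5) (l : ZMod m) :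
    K.edgeFun p j a l ∈ MvPolynomial.restrictTotalDegree (Fin 2) ℝ p := by
  have h3 (A B C A' B' C' : Plane) :
      bary A B C * bary A' B' C' ^ 2 ∈ MvPolynomial.restrictTotalDegree (Fin 2) ℝ p :=
    mul_mem_degree (bary_mem _ _ _) (pow_mem_degree (a := 1) (k := 2) (bary_mem _ _ _) le_rfl) hp
  have h4 (A B C A' B' C' : Plane) :
      bary A B C ^ 2 * bary A' B' C' ∈ MvPolynomial.restrictTotalDegree (Fin 2) ℝ p :=
    mul_mem_degree (pow_mem_degree (a := 1) (k := 2) (bary_mem _ _ _) le_rfl) (bary_mem _ _ _) hp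
  have hm {q r : Poly} (h : q = r) (hr : r ∈ MvPolynomial.restrictTotalDegree (Fin 2) ℝ p) :
      q ∈ MvPolynomial.restrictTotalDegree (Fin 2) ℝ p := h ▸ hr
  by_cases h : l = j
  · subst h
    fin_cases a
    · exact hm (K.cubic_far_self l) (h3 _ _ _ _ _ _)
    · exact hm (K.cubic_far_self l) (h3 _ _ _ _ _ _)
    · exact hm (K.cubic_near_self l) (h4 _ _ _ _ _ _)
    · exact hm (K.cubic_near_self l) (h4 _ _ _ _ _ _)
    · exact hm (K.psi_self p l) (edgePoly_mem hp _ _ _)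
  by_cases h' : l = j - 1
  · subst h'
    fin_cases a
    · exact hm (K.cubic_far_prev j) (h3 _ _ _ _ _ _)
    · exact hm (K.cubic_far_prev j) (h3 _ _ _ _ _ _)
    · exact hm (K.cubic_near_prev j) (h4 _ _ _ _ _ _)
    · exact hm (K.cubic_near_prev j) (h4 _ _ _ _ _ _)
    · exact hm (K.psi_prev p j) (edgePoly_mem hp _ _ _)
  · rw [K.edgeFun_of_ne p h h']
    exact zero_mem _

lemma evalAt_b_self (p : ℕ) (j : ZMod m) (a : Fin 5) (i : Fin 2) (s t : ℝ) :
    evalAt (framePoint K.z (K.P j) (K.P (j + 1)) s t) (K.b p (j, a) j i) =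
      edgeVal p s t a * K.edgeDir j a i := by
  have h := K.orient_ne j
  rw [b_apply, evalAt_mul, evalAt_C]
  congr 1
  fin_cases a
  · refine (congrArg _ (K.cubic_far_self j)).trans ?_
    simp [evalAt_framePoint_bary_fst h, evalAt_framePoint_bary_snd h, edgeVal]
  · refine (congrArg _ (K.cubic_far_self j)).trans ?_
    simp [evalAt_framePoint_bary_fst h, evalAt_framePoint_bary_snd h, edgeVal]
  · refine (congrArg _ (K.cubic_near_self j)).trans ?_
    simp [evalAt_framePoint_bary_fst h, evalAt_framePoint_bary_snd h, edgeVal]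
  · refine (congrArg _ (K.cubic_near_self j)).trans ?_
    simp [evalAt_framePoint_bary_fst h, evalAt_framePoint_bary_snd h, edgeVal]
  · refine (congrArg _ (K.psi_self p j)).trans ?_
    rw [evalAt_framePoint_edgePoly h]
    rfl

lemma evalAt_b_prev (p : ℕ) (j : ZMod m) (a : Fin 5) (i : Fin 2) (s t : ℝ) :
    evalAt (framePoint K.z (K.P j) (K.P (j - 1)) s t) (K.b p (j, a) (j - 1) i) =
      edgeVal p s t a * K.edgeDir j a i := by
  have h := K.orient_prev_ne j
  rw [b_apply, evalAt_mul, evalAt_C]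
  congr 1
  fin_cases a
  · refine (congrArg _ (K.cubic_far_prev j)).trans ?_
    simp [evalAt_framePoint_bary_fst h, evalAt_framePoint_bary_snd h, edgeVal]
  · refine (congrArg _ (K.cubic_far_prev j)).trans ?_
    simp [evalAt_framePoint_bary_fst h, evalAt_framePoint_bary_snd h, edgeVal]
  · refine (congrArg _ (K.cubic_near_prev j)).trans ?_
    simp [evalAt_framePoint_bary_fst h, evalAt_framePoint_bary_snd h, edgeVal]
  · refine (congrArg _ (K.cubic_near_prev j)).trans ?_
    simp [evalAt_framePoint_bary_fst h, evalAt_framePoint_bary_snd h, edgeVal]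
  · refine (congrArg _ (K.psi_prev p j)).trans ?_
    rw [evalAt_framePoint_edgePoly h]
    rfl

lemma lineMap_eq_framePoint_fst (A B C : Plane) (s : ℝ) :
    AffineMap.lineMap A B s = framePoint A B C s 0 := by
  rw [AffineMap.lineMap_apply, framePoint]
  simp [add_comm]

lemma lineMap_eq_framePoint_snd (A B C : Plane) (s : ℝ) :
    AffineMap.lineMap A C s = framePoint A B C 0 s := by
  rw [AffineMap.lineMap_apply, framePoint]
  simp [add_comm]

lemma lineMap_eq_framePoint_opposite (A B C : Plane) (s : ℝ) :
    AffineMap.lineMap B C s = framePoint A B C (1 - s) s := by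
  rw [AffineMap.lineMap_apply, framePoint, vsub_eq_sub, vadd_eq_add]
  module

lemma b_mem_CR {p : ℕ} (hp : 3 ≤ p) (hodd : Odd p) (k : ZMod m × Fin 5) : K.b p k ∈ K.CR p := by
  obtain ⟨k, a⟩ := k
  have hroot {t : ℝ} (ht : (legendre p).eval t = 0) :
      (legendre p).eval (1 - 2 * ((1 + t) / 2)) = 0 := by
    rw [show 1 - 2 * ((1 + t) / 2) = -t by ring, legendre_eval_neg hodd, ht, neg_zero]
  refine ⟨?_, ?_, ?_⟩
  · simp only [PwFieldLE, Submodule.mem_pi, Set.mem_univ, true_imp_iff]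
    intro l i
    rw [b_apply]
    exact mul_mem_degree (K.edgeFun_mem hp _ _ _) (C_mem_degree _ 0) le_rfl
  · rintro j _ ⟨t, -, ht, rfl⟩ i
    by_cases h1 : j = k
    -- On the edge of the field itself, t = 0 in both frames, so the two traces agree along the
    -- entire edge.
    · subst h1
      rw [lineMap_eq_framePoint_fst _ _ (K.P (j + 1)), evalAt_b_self,
        ← lineMap_eq_framePoint_fst, lineMap_eq_framePoint_fst _ _ (K.P (j - 1)), evalAt_b_prev]
    by_cases h2 : j = k + 1
    · subst h2
      rw [K.b_of_ne p (K.add_one_ne k) (K.add_one_ne_sub_one k), add_sub_cancel_right,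
        lineMap_eq_framePoint_snd _ (K.P k), evalAt_b_self, edgeVal_eq_zero (by ring) (hroot ht),
        zero_mul, evalAt_zero]
    have h4 : j - 1 ≠ k := fun h => h2 (by rw [← h, sub_add_cancel])
    have h5 : j - 1 ≠ k - 1 := fun h => h1 (sub_left_injective h)
    rw [K.b_of_ne p h4 h5, evalAt_zero]
    by_cases h3 : j = k - 1
    · subst h3
      rw [lineMap_eq_framePoint_snd _ (K.P k), evalAt_b_prev, edgeVal_eq_zero (by ring) (hroot ht),
        zero_mul]
    · rw [K.b_of_ne p h1 h3, evalAt_zero]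
  · rintro j _ ⟨t, -, ht, rfl⟩ i
    by_cases h1 : j = k
    · subst h1
      rw [lineMap_eq_framePoint_opposite K.z, evalAt_b_self, edgeVal_eq_zero (by ring) (hroot ht),
        zero_mul]
    by_cases h3 : j = k - 1
    · subst h3
      -- In this frame the outer edge is traversed in the opposite sense, so the Legendre argument
      -- is t itself rather than -t.
      rw [sub_add_cancel, lineMap_eq_framePoint_opposite K.z, framePoint_swap, evalAt_b_prev,
        edgeVal_eq_zero (by ring) (by rw [← ht]; congr 1; ring), zero_mul]
    · rw [K.b_of_ne p h1 h3, evalAt_zero]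

lemma V_le_CR {p : ℕ} (hp : 3 ≤ p) (hodd : Odd p) : K.V p ≤ K.CR p := by
  rw [V, Submodule.span_le]
  rintro _ ⟨k, rfl⟩
  exact K.b_mem_CR hp hodd k

lemma lineMap_mem_segment {A B : Plane} {t : ℝ} (ht : t ∈ Set.Ioo (-1 : ℝ) 1) :
    AffineMap.lineMap A B ((1 + t) / 2) ∈ segment ℝ A B := by
  rw [segment_eq_image_lineMap]
  exact ⟨_, ⟨by linarith [ht.1], by linarith [ht.2]⟩, rfl⟩

lemma Bubble_le_CR (p : ℕ) : K.Bubble p ≤ K.CR p := by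
  rintro v ⟨hv, hv0⟩
  refine ⟨hv, ?_, ?_⟩
  · rintro j _ ⟨t, ht, -, rfl⟩ i
    rw [hv0 j _ (Or.inl (Or.inl (lineMap_mem_segment ht))), hv0 (j - 1) _ (Or.inr ?_)]
    rw [sub_add_cancel, segment_symm]
    exact lineMap_mem_segment ht
  · rintro j _ ⟨t, ht, -, rfl⟩ i
    exact hv0 j _ (Or.inl (Or.inr (lineMap_mem_segment ht))) i

variable [NeZero m]

/-- Only the fields of the edges with numbers l and l + 1 live on T_l; seen from the latter edge,
the two affine coordinates are interchanged. -/
lemma evalAt_combination (p : ℕ) (c : ZMod m × Fin 5 → ℝ) (l : ZMod m) (i : Fin 2) (s t : ℝ) :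
    evalAt (framePoint K.z (K.P l) (K.P (l + 1)) s t) ((∑ k, c k • K.b p k) l i) =
      ∑ a, c (l, a) * (edgeVal p s t a * K.edgeDir l a i) +
      ∑ a, c (l + 1, a) * (edgeVal p t s a * K.edgeDir (l + 1) a i) := by
  have h1 (a : Fin 5) : evalAt (framePoint K.z (K.P l) (K.P (l + 1)) s t)
      (K.b p (l + 1, a) l i) = edgeVal p t s a * K.edgeDir (l + 1) a i := by
    have := K.evalAt_b_prev p (l + 1) a i t s
    rwa [add_sub_cancel_right, framePoint_swap] at this
  simp only [Finset.sum_apply, evalAt_sum, Pi.smul_apply, evalAt_smul]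
  rw [Fintype.sum_prod_type, Finset.sum_eq_add l (l + 1) (K.add_one_ne l).symm]
  · simp only [evalAt_b_self, h1]
  · rintro j - ⟨h2, h3⟩
    refine Finset.sum_eq_zero fun a _ => ?_
    rw [K.b_of_ne p h2.symm fun h => h3 (by rw [h, sub_add_cancel]), evalAt_zero, mul_zero]
  · simp
  · simp

/-- The trace on each E_l must vanish. Its value at P_l involves only the functions `psi` of two
adjacent edges, whose normals are independent; then only the two cubics of E_l itself remain, which
are independent along the edge. -/
lemma disjoint_V_Bubble {p : ℕ} (hp : 3 ≤ p) (hodd : Odd p) :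
    Disjoint (K.V p) (K.Bubble p) := by
  rw [Submodule.disjoint_def]
  rintro v hv ⟨-, hv0⟩
  obtain ⟨c, rfl⟩ := (Submodule.mem_span_range_iff_exists_fun ℝ).1 hv
  have hL := derivative_legendre_eval_one_ne_zero hp
  have hneg := legendre_eval_neg hodd 1
  have hone := legendre_eval_one p
  have hedge (l : ZMod m) (i : Fin 2) {s : ℝ} (hs : s ∈ Set.Icc (0 : ℝ) 1) :=
    (K.evalAt_combination p c l i s 0).symm.trans
      (hv0 l _ (Or.inl (Or.inl (framePoint_mem_segment_left hs))) i)
  have h4 (l : ZMod m) : c (l, 4) = 0 := by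
    have h1 (i : Fin 2) : c (l, 4) * K.normal l i - c (l + 1, 4) * K.normal (l + 1) i = 0 := by
      have := hedge l i (s := 1) (by simp)
      simp only [Fin.sum_univ_five, edgeVal, edgeDir, Matrix.cons_val] at this
      norm_num [hone, hneg] at this
      field_simp at this
      linarith
    have h2 := h1 0
    have h3 := h1 1
    have hD := K.orient_ne l
    have hE := (K.edgeLength_pos l).ne'
    have hE' := (K.edgeLength_pos (l + 1)).ne'
    simp only [normal, tangent, PiLp.smul_apply, PiLp.sub_apply, smul_eq_mul] at h2 h3
    simp at h2 h3
    field_simp at h2 h3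
    unfold orient at hD
    -- The inner product with P_{l+1} - z removes the normal of the edge l + 1 and leaves the
    -- nonzero determinant of T_l.
    rw [← mul_left_inj' (mul_ne_zero hE' hD), zero_mul]
    linear_combination (K.P (l + 1) 0 - K.z 0) * h2 + (K.P (l + 1) 1 - K.z 1) * h3
  have hrest (l : ZMod m) : c (l, 0) = 0 ∧ c (l, 1) = 0 ∧ c (l, 2) = 0 ∧ c (l, 3) = 0 := by
    have h1 (i : Fin 2) : c (l, 0) * K.normal l i + c (l, 1) * K.tangent l i = 0 ∧
        c (l, 2) * K.normal l i + c (l, 3) * K.tangent l i = 0 := by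
      -- Two sample points suffice to separate s(1 - s)² from s²(1 - s).
      have e1 := hedge l i (s := 1 / 2) (by norm_num)
      have e2 := hedge l i (s := 1 / 3) (by norm_num)
      simp only [Fin.sum_univ_five, edgeVal, edgeDir, Matrix.cons_val, h4] at e1 e2
      norm_num at e1 e2
      constructor <;> linarith
    have h0 : K.tangent l 0 ^ 2 + K.tangent l 1 ^ 2 ≠ 0 := by
      have hE := (K.edgeLength_pos l).ne'
      have hS := (K.edgeSq_pos l).ne'
      have : K.tangent l 0 ^ 2 + K.tangent l 1 ^ 2 = (K.edgeLength l)⁻¹ ^ 2 * K.edgeSq l := by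
        simp [tangent, edgeSq]; ring
      rw [this]
      positivity
    have h2 := h1 0
    have h3 := h1 1
    simp [normal] at h2 h3
    refine ⟨?_, ?_, ?_, ?_⟩ <;> rw [← mul_left_inj' h0, zero_mul]
    · linear_combination K.tangent l 1 * h2.1 - K.tangent l 0 * h3.1
    · linear_combination K.tangent l 0 * h2.1 + K.tangent l 1 * h3.1
    · linear_combination K.tangent l 1 * h2.2 - K.tangent l 0 * h3.2
    · linear_combination K.tangent l 0 * h2.2 + K.tangent l 1 * h3.2
  refine Finset.sum_eq_zero fun k _ => ?_
  obtain ⟨l, a⟩ := k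
  have : c (l, a) = 0 := by
    obtain ⟨e0, e1, e2, e3⟩ := hrest l
    fin_cases a
    exacts [e0, e1, e2, e3, h4 l]
  rw [this, zero_smul]

end NodalPatch
end CrouzeixRaviart

/-! ### The range of the divergence -/

namespace CrouzeixRaviart
namespace NodalPatch

variable {m : ℕ} (K : NodalPatch m)

lemma divPw_mem_PwPolyLE {p : ℕ} {v : PwField m} (hv : v ∈ PwFieldLE m p) :
    divPw m v ∈ PwPolyLE m (p - 1) := by
  simp only [PwFieldLE, PwPolyLE, Submodule.mem_pi, Set.mem_univ, true_imp_iff] at hv ⊢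
  exact fun j => Submodule.sum_mem _ fun i _ => pderiv_mem_degree i (hv j i)

lemma mem_triangleBubble {p : ℕ} {v : PwField m} (hv : v ∈ K.Bubble p) (j : ZMod m) :
    v j ∈ triangleBubble K.z (K.P j) (K.P (j + 1)) p := by
  obtain ⟨h1, h2⟩ := hv
  simp only [PwFieldLE, Submodule.mem_pi, Set.mem_univ, true_imp_iff] at h1
  exact ⟨h1 j, h2 j⟩

lemma mem_Bubble {p : ℕ} {v : PwField m}
    (hv : ∀ j, v j ∈ triangleBubble K.z (K.P j) (K.P (j + 1)) p) : v ∈ K.Bubble p := by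
  refine ⟨?_, fun j => (hv j).2⟩
  simp only [PwFieldLE, Submodule.mem_pi, Set.mem_univ, true_imp_iff]
  exact fun j => (hv j).1

variable [NeZero m]

lemma patchIntegral_apply (g : PwPoly m) : K.patchIntegral g =
    ∑ j, triangleIntegral K.z (K.P j) (K.P (j + 1)) (g j) := by
  simp [patchIntegral]

/-- Pairing a row of `M` with `s` gives the patch integral of the divergence, so `s` lying in the
kernel is precisely this claim. -/
lemma patchIntegral_divPw_b {p : ℕ} (hp : 3 ≤ p) (hodd : Odd p) (k : ZMod m × Fin 5) :
    K.patchIntegral (divPw m (K.b p k)) = 0 := by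
  have h1 := congrFun ((K.mulVec_M_eq_zero_iff hp hodd K.s).2 ⟨1, one_smul _ _⟩) k
  rw [patchIntegral_apply]
  simpa [Matrix.mulVec, dotProduct, Fintype.sum_prod_type, Fin.sum_univ_four, s, M, Lam] using h1

lemma map_divPw_le {p : ℕ} (hp : 3 ≤ p) (hodd : Odd p) :
    Submodule.map (divPw m) (K.V p ⊔ K.Bubble p) ≤ K.Pressure (p - 1) := by
  rw [Submodule.map_le_iff_le_comap, Pressure, Submodule.comap_inf]
  refine le_inf (fun v hv => ?_) (sup_le ?_ fun v hv => ?_)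
  · exact divPw_mem_PwPolyLE ((sup_le (K.V_le_CR hp hodd) (K.Bubble_le_CR p)) hv).1
  · rw [V, Submodule.span_le]
    rintro _ ⟨k, rfl⟩
    exact K.patchIntegral_divPw_b hp hodd k
  · rw [Submodule.mem_comap, LinearMap.mem_ker, patchIntegral_apply]
    refine Finset.sum_eq_zero fun j _ => ?_
    rw [divPw_apply_eq]
    exact triangleIntegral_polyDiv_bubble (K.orient_ne j) (K.mem_triangleBubble hv j)

/-- The functional `Lam` as a linear map. -/
def LamLin (jc : ZMod m × Fin 4) : PwPoly m →ₗ[ℝ] ℝ where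
  toFun := K.Lam jc
  map_add' g h := by
    obtain ⟨j, c⟩ := jc
    fin_cases c <;> simp [Lam]
  map_smul' r g := by
    obtain ⟨j, c⟩ := jc
    fin_cases c <;> simp [Lam]

lemma le_map_divPw {p : ℕ} (hp : 3 ≤ p) (hodd : Odd p) :
    K.Pressure (p - 1) ≤ Submodule.map (divPw m) (K.V p ⊔ K.Bubble p) := by
  rintro g ⟨hg, hg0⟩
  rw [SetLike.mem_coe, LinearMap.mem_ker, patchIntegral_apply] at hg0
  -- The integral entries of g sum to its patch integral, which is zero; hence the coefficients c
  -- match all functionals of g.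
  obtain ⟨c, hc⟩ := K.exists_vecMul_M_eq hp hodd (t := fun l => K.Lam l g)
    (by simpa [Lam] using hg0)
  set v : PwField m := ∑ k, c k • K.b p k with hv
  have hvV : v ∈ K.V p := Submodule.sum_mem _ fun k _ =>
    Submodule.smul_mem _ _ (Submodule.subset_span ⟨k, rfl⟩)
  have hLam (l : ZMod m × Fin 4) : K.Lam l (g - divPw m v) = 0 := by
    have h1 : K.LamLin l (g - divPw m v) = K.Lam l g - ∑ k, c k * K.Lam l (divPw m (K.b p k)) := by
      simp only [hv, map_sub, map_sum, map_smul, smul_eq_mul]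
      rfl
    refine h1.trans ?_
    rw [← congrFun hc l]
    exact sub_self _
  have hdeg : g - divPw m v ∈ PwPolyLE m (p - 1) :=
    sub_mem hg (divPw_mem_PwPolyLE (K.V_le_CR hp hodd hvV).1)
  simp only [PwPolyLE, Submodule.mem_pi, Set.mem_univ, true_imp_iff] at hdeg
  have hex (j : ZMod m) : ∃ w ∈ triangleBubble K.z (K.P j) (K.P (j + 1)) p,
      polyDiv w = (g - divPw m v) j := by
    -- The remainder has degree p - 1 ≥ 2 at most and all four functionals vanish on each triangle,
    -- so a bubble of degree p corrects it locally.
    have := exists_bubble_polyDiv_eq (K.orient_ne j) (k := p - 1) (by omega) (hdeg j)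
      (hLam (j, 0)) (hLam (j, 1)) (hLam (j, 2)) (hLam (j, 3))
    rwa [Nat.sub_add_cancel (by omega)] at this
  choose w hw hwdiv using hex
  refine ⟨v + w, add_mem (Submodule.mem_sup_left hvV)
    (Submodule.mem_sup_right (K.mem_Bubble hw)), ?_⟩
  have : divPw m w = g - divPw m v := funext fun j => by rw [divPw_apply_eq, hwdiv]
  rw [map_add, this, add_sub_cancel]

end NodalPatch
end CrouzeixRaviart

end

theorem mainTheorem2 {m : ℕ} [NeZero m] (K : CrouzeixRaviart.NodalPatch m)
    (p : ℕ) (hp : 3 ≤ p) (hodd : Odd p) :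
    LinearMap.ker (K.A p).mulVecLin = Submodule.span ℝ {K.v0} ∧
    Module.finrank ℝ (LinearMap.ker (K.A p).mulVecLin) = 1 ∧
    LinearMap.ker (K.M p).mulVecLin = Submodule.span ℝ {K.s} ∧
    K.V p ≤ K.CR p ∧
    K.Bubble p ≤ K.CR p ∧
    Disjoint (K.V p) (K.Bubble p) ∧
    Submodule.map (CrouzeixRaviart.divPw m) (K.V p ⊔ K.Bubble p) = K.Pressure (p - 1) := by
  exact ⟨K.ker_A hp hodd, K.finrank_ker_A hp hodd, K.ker_M hp hodd, K.V_le_CR hp hodd,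
    K.Bubble_le_CR p, K.disjoint_V_Bubble hp hodd,
    le_antisymm (K.map_divPw_le hp hodd) (K.le_map_divPw hp hodd)⟩
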